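/- Let $q$ be a power of an odd prime and $n\ge 0$. Let $UT_n=UT_n(\mathbb F_q)$ be the group of upper unitriangular $n\times n$ matrices over $\mathbb F_q$, $\mathfrak{ut}_n$ the algebra of strictly upper triangular matrices, $J$ the $n\times n$ matrix with ones on the antidiagonal and zeroes elsewhere, $x^\dagger=Jx^tJ$, and $$UO_n=\{g\in UT_n\mid g^{-1}=g^\dagger\},\qquad \mathfrak{uo}_n=\{x\in\mathfrak{ut}_n\mid x^\dagger=-x\}.$$ A supercharacter theory of a finite group is a pair $(\mathcal K,\mathcal X)$ consisting of a partition $\mathcal K$ of the group into unions of conjugacy classes (the superclasses) and a set $\mathcal X$ of characters (the supercharacters) with $|\mathcal X|=|\mathcal K|$, such that every $\chi\in\mathcal X$ is constant on every member of $\mathcal K$ and every irreducible character is a constituent of exactly one $\chi\in\mathcal X$. *The theory defined by the anti-involution.* Let $f:UT_n\to\mathfrak{ut}_n$ be any Springer morphism, that is, a bijection with $f(UO_n)=\mathfrak{uo}_n$ and $f(1+x)=x+\sum_{i\ge2}a_ix^i$ for some $a_i\in\mathbb F_q$, and let $\theta:\mathbb F_q^+\to\mathbb C^\times$ be any nontrivial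 homomorphism. $UT_n$ acts on $\mathfrak{uo}_n$ by $g\cdot x=gxg^\dagger$ and on the dual space $\mathfrak{uo}_n^*$ by $(g\cdot\lambda)(x)=\lambda(g^{-1}\cdot x)$. Let $H$ be the group of $h\in UT_n$ with $h_{ij}=0$ whenever $i\ne j$ and $j\le n/2$. For $u\in UO_n$ and $\lambda\in\mathfrak{uo}_n^*$ put $$K_u=\{v\in UO_n\mid f(v)\in UT_n\cdot f(u)\},\qquad \chi_\lambda=\frac{|H\cdot\lambda|}{|UT_n\cdot\lambda|}\sum_{\mu\in UT_n\cdot\lambda}\theta\circ\mu\circ f .$$ *The theory of André and Neto.* Write $\bar i=n+1-i$. A root is a pair $(i,j)$ with $1\le i<j\le n$ and $i<\bar j$. A set $D$ of roots is basic if $D\cup\{(\bar j,\bar i)\mid (i,j)\in D\}$ has at most one element in each row and at most one in each column. For a basic set $D$ and a map $\varphi:D\to\mathbb F_q^\times$ put $e_{D,\varphi}=\sum_{(i,j)\in D}\varphi(i,j)(e_{ij}-e_{\bar j\bar i})$. The superclass of $(D,\varphi)$ is $$K_{D,\varphi}=\{u\in UO_n\mid u-1\in UT_n\,e_{D,\varphi}\,UT_n\}.$$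 Let $\theta':\mathbb F_q^+\to\mathbb C^\times$ be any nontrivial homomorphism. For a root $(i,j)$ and $r\in\mathbb F_q^\times$, the elementary character $\xi_{(i,j),r}$ is induced to $UO_n$ from the linear character $u\mapsto\theta'(r\,u_{ij})$ of the subgroup $\{u\in UO_n\mid u_{ik}=0\text{ for } i<k<j\}$. The supercharacter of $(D,\varphi)$ is $\xi_{D,\varphi}=\prod_{(i,j)\in D}\xi_{(i,j),\varphi(i,j)}$. **Theorem.** The pairs $(\{K_u\},\{\chi_\lambda\})$ and $(\{K_{D,\varphi}\},\{\xi_{D,\varphi}\})$ are supercharacter theories of $UO_n$, and they coincide: 1. $\{K_u\mid u\in UO_n\}=\{K_{D,\varphi}\mid D\text{ basic},\ \varphi:D\to\mathbb F_q^\times\}$, and these are exactly the nonempty sets $UO_n\cap K_g$ with $g\in UT_n$, where $K_g=\{h\in UT_n\mid h-1\in UT_n\,(g-1)\,UT_n\}$ is the superclass of $g$ in the algebra group supercharacter theory of $UT_n$. 2. The supercharacters are the same up to normalization by positive constants. Precisely, $\{\chi_\lambda\mid\lambda\in\mathfrak{uo}_n^*\}=\{q^{c(D)}\,\xi_{D,\varphi}\mid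 D\text{ basic},\ \varphi:D\to\mathbb F_q^\times\}$, where $c(D)=0$ if $n$ is even and $c(D)=|\{(i,j)\in D\mid \bar j<j\}|$ if $n$ is odd. In particular the two sets of supercharacters are equal if $n$ is even. -/

import Mathlib

namespace UnipOrth

/-! ### Supercharacter theories of a finite group -/

section Characters

variable {G : Type*} [Group G]

/-- `χ` is the character of a nonzero finite-dimensional complex representation of `G`. -/
def IsCharacter (χ : G → ℂ) : Prop :=
  ∃ (d : ℕ) (ρ : Representation ℂ G (Fin d → ℂ)), 0 < d ∧ χ = ρ.character

/-- `χ` is the character of an irreducible finite-dimensional complex representation of `G`. -/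
def IsIrredCharacter (χ : G → ℂ) : Prop :=
  ∃ (d : ℕ) (ρ : Representation ℂ G (Fin d → ℂ)), ρ.IsIrreducible ∧ χ = ρ.character

/-- The inner product of two class functions (`G` is finite wherever this is used). -/
noncomputable def charInner (χ ψ : G → ℂ) : ℂ :=
  (Nat.card G : ℂ)⁻¹ * ∑ᶠ g : G, χ g * star (ψ g)

/-- `(K, X)` is a supercharacter theory of the finite group `G`, with set of superclasses `K`
and set of supercharacters `X`. -/
structure IsSupercharacterTheory (K : Set (Set G)) (X : Set (G → ℂ)) : Prop where
  partition : Setoid.IsPartition K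
  conj_mem : ∀ S ∈ K, ∀ x ∈ S, ∀ g : G, g * x * g⁻¹ ∈ S
  isCharacter : ∀ χ ∈ X, IsCharacter χ
  card_eq : X.ncard = K.ncard
  constant : ∀ χ ∈ X, ∀ S ∈ K, ∀ x ∈ S, ∀ y ∈ S, χ x = χ y
  constituent : ∀ ψ : G → ℂ, IsIrredCharacter ψ → ∃! χ, χ ∈ X ∧ charInner χ ψ ≠ 0

/-- The class function of `G` induced from the function `lam` on the subgroup `H`
(only the values of `lam` on `H` matter; `G` is finite wherever this is used). -/
noncomputable def induced (H : Subgroup G) (lam : G → ℂ) (g : G) : ℂ :=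
  (Nat.card H : ℂ)⁻¹ * ∑ᶠ x : G, (H : Set G).indicator lam (x⁻¹ * g * x)

end Characters

/-! ### Unitriangular and unipotent orthogonal groups -/

section Groups

variable (n : ℕ) (F : Type*) [Field F]

/-- The group of upper triangular `n × n` matrices with ones on the diagonal. -/
def UT : Subgroup (GL (Fin n) F) where
  carrier := {g | (∀ i j, j < i → (g : Matrix (Fin n) (Fin n) F) i j = 0) ∧
    ∀ i, (g : Matrix (Fin n) (Fin n) F) i i = 1}
  one_mem' := by
    refine ⟨fun i j h => ?_, fun i => ?_⟩
    · simp [h.ne']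
    · simp
  mul_mem' := by
    rintro a b ⟨ha, ha'⟩ ⟨hb, hb'⟩
    refine ⟨fun i j h => ?_, fun i => ?_⟩
    · rw [Units.val_mul, Matrix.mul_apply]
      refine Finset.sum_eq_zero fun k _ => ?_
      rcases lt_or_ge k i with hk | hk
      · rw [ha i k hk, zero_mul]
      · rw [hb k j (h.trans_le hk), mul_zero]
    · rw [Units.val_mul, Matrix.mul_apply, Finset.sum_eq_single i]
      · rw [ha' i, hb' i, one_mul]
      · intro k _ hk
        rcases lt_or_gt_of_ne hk with hk | hk
        · rw [ha i k hk, zero_mul]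
        · rw [hb k i hk, mul_zero]
      · simp
  inv_mem' := by
    rintro a ⟨ha, ha'⟩
    have key : ∀ i j, j < i → ((a⁻¹ : GL (Fin n) F) : Matrix (Fin n) (Fin n) F) i j = 0 := by
      have hinv : Invertible (a : Matrix (Fin n) (Fin n) F) := a.invertible
      have hb : ((a : Matrix (Fin n) (Fin n) F)).BlockTriangular id := fun i j h => ha i j h
      intro i j h
      rw [Matrix.coe_units_inv]
      exact Matrix.blockTriangular_inv_of_blockTriangular hb h
    refine ⟨key, fun i => ?_⟩
    have h1 : ((a : Matrix (Fin n) (Fin n) F) *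
        ((a⁻¹ : GL (Fin n) F) : Matrix (Fin n) (Fin n) F)) i i = 1 := by
      rw [← Units.val_mul, mul_inv_cancel]
      simp
    rw [Matrix.mul_apply, Finset.sum_eq_single i] at h1
    · rwa [ha' i, one_mul] at h1
    · intro k _ hk
      rcases lt_or_gt_of_ne hk with hk | hk
      · rw [ha i k hk, zero_mul]
      · rw [key k i hk, mul_zero]
    · simp

/-- The algebra of strictly upper triangular matrices. -/
def ut : Submodule F (Matrix (Fin n) (Fin n) F) where
  carrier := {x | ∀ i j, j ≤ i → x i j = 0}
  zero_mem' := fun _ _ _ => rfl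
  add_mem' := by
    intro a b ha hb i j h
    rw [Matrix.add_apply, ha i j h, hb i j h, add_zero]
  smul_mem' := by
    intro c a ha i j h
    rw [Matrix.smul_apply, ha i j h, smul_zero]

/-- The matrix with ones on the antidiagonal and zeroes elsewhere. -/
def J : Matrix (Fin n) (Fin n) F := Matrix.of fun i j => if j = Fin.rev i then 1 else 0

variable {n F}

/-- The anti-involution `x ↦ J xᵗ J`. -/
def dagger (x : Matrix (Fin n) (Fin n) F) : Matrix (Fin n) (Fin n) F :=
  J n F * x.transpose * J n F

theorem dagger_apply (x : Matrix (Fin n) (Fin n) F) (i j : Fin n) :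
    dagger x i j = x (Fin.rev j) (Fin.rev i) := by
  have h : ∀ k : Fin n, (j = Fin.rev k) = (k = Fin.rev j) := fun k =>
    propext ⟨fun h => by rw [h, Fin.rev_rev], fun h => by rw [h, Fin.rev_rev]⟩
  simp [dagger, J, Matrix.mul_apply, h]

theorem dagger_mul (x y : Matrix (Fin n) (Fin n) F) :
    dagger (x * y) = dagger y * dagger x := by
  ext i j
  simp only [dagger_apply, Matrix.mul_apply]
  rw [← Equiv.sum_comp Fin.revPerm]
  exact Finset.sum_congr rfl fun k _ => by simp [mul_comm]

theorem dagger_one : dagger (1 : Matrix (Fin n) (Fin n) F) = 1 := by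
  ext i j
  simp [dagger_apply, Matrix.one_apply, eq_comm]

theorem dagger_dagger (x : Matrix (Fin n) (Fin n) F) : dagger (dagger x) = x := by
  ext i j
  simp [dagger_apply]

theorem dagger_add (x y : Matrix (Fin n) (Fin n) F) :
    dagger (x + y) = dagger x + dagger y := by
  ext i j
  simp [dagger_apply]

theorem dagger_smul (c : F) (x : Matrix (Fin n) (Fin n) F) :
    dagger (c • x) = c • dagger x := by
  ext i j
  simp [dagger_apply]

/-- The underlying matrix of an element of `UT n F`. -/
def mat (g : UT n F) : Matrix (Fin n) (Fin n) F := ((g : GL (Fin n) F) : Matrix (Fin n) (Fin n) F)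

theorem mat_mul (g h : UT n F) : mat (g * h) = mat g * mat h := rfl

theorem mat_one : mat (1 : UT n F) = 1 := rfl

theorem mat_injective : Function.Injective (mat : UT n F → Matrix (Fin n) (Fin n) F) :=
  fun _ _ h => Subtype.ext (Units.ext h)

theorem mat_mul_inv (g : UT n F) : mat g * mat g⁻¹ = 1 := by
  rw [← mat_mul, mul_inv_cancel, mat_one]

theorem mat_inv_mul (g : UT n F) : mat g⁻¹ * mat g = 1 := by
  rw [← mat_mul, inv_mul_cancel, mat_one]

variable (n F)

/-- The unipotent orthogonal group `UO_n`: the `g` in `UT_n` with `g⁻¹ = J gᵗ J`. -/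
def UO : Subgroup (UT n F) where
  carrier := {g | mat g⁻¹ = dagger (mat g)}
  one_mem' := by
    simp [mat_one, dagger_one]
  mul_mem' := by
    intro a b ha hb
    change mat (a * b)⁻¹ = dagger (mat (a * b))
    rw [mul_inv_rev, mat_mul, mat_mul, dagger_mul, ha, hb]
  inv_mem' := by
    intro a ha
    change mat a⁻¹⁻¹ = dagger (mat a⁻¹)
    rw [inv_inv, ha, dagger_dagger]

/-- The Lie algebra `uo_n` of strictly upper triangular `x` with `J xᵗ J = -x`. -/
def uo : Submodule F (Matrix (Fin n) (Fin n) F) where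
  carrier := {x | x ∈ ut n F ∧ dagger x = -x}
  zero_mem' := by
    refine ⟨Submodule.zero_mem _, ?_⟩
    ext i j
    simp [dagger_apply]
  add_mem' := by
    rintro a b ⟨ha, ha'⟩ ⟨hb, hb'⟩
    refine ⟨Submodule.add_mem _ ha hb, ?_⟩
    rw [dagger_add, ha', hb', neg_add]
  smul_mem' := by
    rintro c a ⟨ha, ha'⟩
    refine ⟨Submodule.smul_mem _ c ha, ?_⟩
    rw [dagger_smul, ha', smul_neg]

end Groups

/-! ### The supercharacter theory coming from the anti-involution -/

section Construction

variable {n : ℕ} {F : Type*} [Field F]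

theorem conj_mem_uo (g : UT n F) {x : Matrix (Fin n) (Fin n) F} (hx : x ∈ uo n F) :
    mat g * x * dagger (mat g) ∈ uo n F := by
  obtain ⟨hx, hx'⟩ := hx
  refine ⟨fun i j hij => ?_, ?_⟩
  · rw [Matrix.mul_apply]
    refine Finset.sum_eq_zero fun l _ => ?_
    rcases lt_or_ge j l with hl | hl
    · rw [dagger_apply, show mat g (Fin.rev j) (Fin.rev l) = 0 from
        g.2.1 _ _ (Fin.rev_lt_rev.mpr hl), mul_zero]
    · rw [Matrix.mul_apply, Finset.sum_eq_zero, zero_mul]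
      intro k _
      rcases lt_or_ge k i with hk | hk
      · rw [show mat g i k = 0 from g.2.1 _ _ hk, zero_mul]
      · rw [hx k l ((hl.trans hij).trans hk), mul_zero]
  · rw [dagger_mul, dagger_mul, dagger_dagger, hx', neg_mul, mul_neg, mul_assoc]

/-- The action `g · x = g x g†` of `UT_n` on `uo_n`. -/
def act (g : UT n F) : uo n F →ₗ[F] uo n F where
  toFun x := ⟨mat g * x * dagger (mat g), conj_mem_uo g x.2⟩
  map_add' x y := Subtype.ext (by simp [mul_add, add_mul])
  map_smul' c x := Subtype.ext (by simp)

/-- The set of all `g · lam` with `g ∈ S`, for the dual action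
`(g · lam)(x) = lam (g⁻¹ · x)` of `UT_n` on the dual space of `uo_n`. -/
def dualOrbit (S : Set (UT n F)) (lam : Module.Dual F (uo n F)) :
    Set (Module.Dual F (uo n F)) :=
  {μ | ∃ g ∈ S, μ = lam ∘ₗ act g⁻¹}

variable (n F)

/-- The subgroup `H = 1 + h` of `UT_n`, where `h` consists of the strictly upper triangular
matrices whose `j`-th column vanishes for `j ≤ n / 2` (here the columns are counted from one,
so that the index `j : Fin n` stands for column `j + 1`). -/
def H : Set (UT n F) := {g | ∀ i j : Fin n, i ≠ j → 2 * ((j : ℕ) + 1) ≤ n → mat g i j = 0}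

/-- Springer morphisms from `UT_n` to its algebra, with respect to the anti-involution `dagger`.
Since `(g - 1) ^ n = 0` for every `g` in `UT_n`, the power series in `g - 1` is a finite sum. -/
structure SpringerMorphism where
  toFun : UT n F → Matrix (Fin n) (Fin n) F
  injective : Function.Injective toFun
  range_eq : Set.range toFun = (ut n F : Set (Matrix (Fin n) (Fin n) F))
  image_UO : toFun '' (UO n F : Set (UT n F)) = (uo n F : Set (Matrix (Fin n) (Fin n) F))
  exists_coeff : ∃ a : ℕ → F, ∀ g : UT n F,
    toFun g = (mat g - 1) + ∑ i ∈ Finset.Ico 2 n, a i • (mat g - 1) ^ i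

variable {n F}

/-- The restriction of a Springer morphism to a map from `UO_n` to `uo_n`. -/
def SpringerMorphism.onUO (f : SpringerMorphism n F) (u : UO n F) : uo n F :=
  ⟨f.toFun u, by
    have h : f.toFun u ∈ f.toFun '' (UO n F : Set (UT n F)) := ⟨u, u.2, rfl⟩
    rw [f.image_UO] at h
    exact h⟩

/-- The superclass `K_u` of `u ∈ UO_n`: all `v ∈ UO_n` with `f(v) ∈ UT_n · f(u)`. -/
def superclass (f : SpringerMorphism n F) (u : UO n F) : Set (UO n F) :=
  {v | ∃ g : UT n F, f.onUO v = act g (f.onUO u)}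

/-- The constant `n_λ = |UT_n · λ| / |H · λ|`. -/
noncomputable def nConst (lam : Module.Dual F (uo n F)) : ℂ :=
  ((dualOrbit Set.univ lam).ncard : ℂ) / ((dualOrbit (H n F) lam).ncard : ℂ)

/-- The supercharacter `χ_λ`, that is `n_λ⁻¹` times the sum of the functions `θ ∘ μ ∘ f` over
all `μ` in the orbit `UT_n · λ` (a finite set when `F` is finite). -/
noncomputable def supercharacter (f : SpringerMorphism n F) (θ : AddChar F ℂ)
    (lam : Module.Dual F (uo n F)) (u : UO n F) : ℂ :=
  1 / nConst lam * ∑ᶠ μ ∈ dualOrbit Set.univ lam, θ (μ (f.onUO u))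

/-- The set of all superclasses `K_u`. -/
def superclasses (f : SpringerMorphism n F) : Set (Set (UO n F)) :=
  Set.range (superclass f)

/-- The set of all supercharacters `χ_λ`. -/
def supercharacters (f : SpringerMorphism n F) (θ : AddChar F ℂ) : Set (UO n F → ℂ) :=
  Set.range (supercharacter f θ)

/-- The superclass of `g` in the algebra group supercharacter theory of `UT_n`:
all `h` with `h - 1 ∈ UT_n (g - 1) UT_n`. -/
def algSuperclass (g : UT n F) : Set (UT n F) :=
  {h | ∃ a b : UT n F, mat h - 1 = mat a * (mat g - 1) * mat b}

end Construction

/-! ### The supercharacter theory of André and Neto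

A positive root is encoded by the position `(i, j)` with `i < j` and `i < rev j`; its mirror image
across the antidiagonal is `(rev j, rev i)`. With positions counted from one, so that
`rev j = n + 1 - j`, and with `m = ⌊n / 2⌋`, the position `(i, j)` stands for `ε_i - ε_j` if
`j ≤ m`, for `ε_i` if `n` is odd and `j = m + 1`, and for `ε_i + ε_(rev j)` otherwise. -/

section AndreNeto

variable {n : ℕ}

/-- The mirror image of a position across the antidiagonal. -/
def mirror (p : Fin n × Fin n) : Fin n × Fin n := (Fin.rev p.2, Fin.rev p.1)

/-- A set `D` of positive roots is basic if the union of `D` with its mirror image contains at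
most one position in each row and at most one position in each column. -/
def IsBasic (D : Finset (Fin n × Fin n)) : Prop :=
  (∀ p ∈ D, p.1 < p.2 ∧ p.1 < Fin.rev p.2) ∧
  ∀ p ∈ D ∪ D.image mirror, ∀ p' ∈ D ∪ D.image mirror, p.1 = p'.1 ∨ p.2 = p'.2 → p = p'

variable {F : Type*} [Field F]

/-- The element `∑ φ(i, j) (e_(i,j) - e_(rev j, rev i))` of `uo_n`, summed over `(i, j) ∈ D`. -/
def basicElement (D : Finset (Fin n × Fin n)) (φ : Fin n × Fin n → F) :
    Matrix (Fin n) (Fin n) F :=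
  ∑ p ∈ D, (Matrix.single p.1 p.2 (φ p) - Matrix.single (Fin.rev p.2) (Fin.rev p.1) (φ p))

/-- The superclass of `UO_n` attached to `(D, φ)`: all `u ∈ UO_n` with
`u - 1 ∈ UT_n e_D(φ) UT_n`. -/
def anSuperclass (D : Finset (Fin n × Fin n)) (φ : Fin n × Fin n → F) : Set (UO n F) :=
  {u | ∃ a b : UT n F, mat (u : UT n F) - 1 = mat a * basicElement D φ * mat b}

/-- The subgroup of `UO_n` attached to the position `p = (i, j)`: all `u ∈ UO_n` with
`u_(i,k) = 0` for `i < k < j`. -/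
def rootSubgroup (n : ℕ) (F : Type*) [Field F] (p : Fin n × Fin n) : Subgroup (UO n F) where
  carrier := {u | ∀ k, p.1 < k → k < p.2 → mat (u : UT n F) p.1 k = 0}
  one_mem' := by
    intro k hk _
    simp [mat_one, hk.ne]
  mul_mem' := by
    intro a b ha hb k hk hk'
    rw [Subgroup.coe_mul, mat_mul, Matrix.mul_apply]
    refine Finset.sum_eq_zero fun l _ => ?_
    rcases lt_trichotomy l p.1 with hl | hl | hl
    · rw [show mat (a : UT n F) p.1 l = 0 from (a : UT n F).2.1 _ _ hl, zero_mul]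
    · rw [hl, hb k hk hk', mul_zero]
    · rcases le_or_gt l k with hlk | hlk
      · rw [ha l hl (hlk.trans_lt hk'), zero_mul]
      · rw [show mat (b : UT n F) l k = 0 from (b : UT n F).2.1 _ _ hlk, mul_zero]
  inv_mem' := by
    intro a ha k hk hk'
    have h : (mat (a : UT n F) * mat (a : UT n F)⁻¹) p.1 k = 0 := by
      rw [mat_mul_inv, Matrix.one_apply, if_neg hk.ne]
    rw [Matrix.mul_apply, Finset.sum_eq_single p.1] at h
    · rwa [show mat (a : UT n F) p.1 p.1 = 1 from (a : UT n F).2.2 _, one_mul] at h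
    · intro l _ hl
      rcases lt_or_gt_of_ne hl with hl | hl
      · rw [show mat (a : UT n F) p.1 l = 0 from (a : UT n F).2.1 _ _ hl, zero_mul]
      · rcases le_or_gt l k with hlk | hlk
        · rw [ha l hl (hlk.trans_lt hk'), zero_mul]
        · rw [show mat (a : UT n F)⁻¹ l k = 0 from (a : UT n F)⁻¹.2.1 _ _ hlk, mul_zero]
    · simp

/-- The elementary character attached to the position `p = (i, j)` and the scalar `r`: it is
induced to `UO_n` from the linear character `u ↦ θ (r u_(i,j))` of the root subgroup. -/
noncomputable def elementaryCharacter (θ : AddChar F ℂ) (p : Fin n × Fin n) (r : F) :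
    UO n F → ℂ :=
  induced (rootSubgroup n F p) fun u => θ (r * mat (u : UT n F) p.1 p.2)

/-- The supercharacter of `UO_n` attached to `(D, φ)`: the product of the elementary characters
attached to the roots in `D`. -/
noncomputable def anSupercharacter (θ : AddChar F ℂ) (D : Finset (Fin n × Fin n))
    (φ : Fin n × Fin n → F) : UO n F → ℂ :=
  fun u => ∏ p ∈ D, elementaryCharacter θ p (φ p) u

variable (n F)

/-- The set of all superclasses in the theory of André and Neto. -/
def anSuperclasses : Set (Set (UO n F)) :=
  {S | ∃ (D : Finset (Fin n × Fin n)) (φ : Fin n × Fin n → F),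
    IsBasic D ∧ (∀ p ∈ D, φ p ≠ 0) ∧ S = anSuperclass D φ}

variable {F}

/-- The set of all supercharacters in the theory of André and Neto. -/
def anSupercharacters (θ : AddChar F ℂ) : Set (UO n F → ℂ) :=
  {χ | ∃ (D : Finset (Fin n × Fin n)) (φ : Fin n × Fin n → F),
    IsBasic D ∧ (∀ p ∈ D, φ p ≠ 0) ∧ χ = anSupercharacter θ D φ}

variable {n}

/-- The exponent that compares the two normalizations: `0` if `n` is even, and the number of
`(i, j) ∈ D` strictly to the right of the middle column if `n` is odd. -/
def normExponent (D : Finset (Fin n × Fin n)) : ℕ :=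
  if Even n then 0 else (D.filter fun p => Fin.rev p.2 < p.2).card

end AndreNeto

end UnipOrth

namespace UnipOrth

/-! ### Characters of finite groups -/

section CharacterTheory

open Representation Module

variable {G : Type*} [Group G]

/-! Both theories are indexed by the monomial elements `e` of `uo n F` (the set `basics`), which are
the same thing as pairs (D, φ).

Superclasses. In odd characteristic every skew matrix is congruent, via x ↦ g x g†, to a monomial
one (`exists_isMonomial_congr`), and a monomial matrix is determined even by its two-sided orbit UT
e UT (`IsMonomial.eq_of_mul_mul`). So on `uo n F` congruence and two-sided equivalence are the same
relation (`exists_act_of_mul_mul`). Since f(u) = (u - 1)w with w unitriangular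
(`exists_springer_eq_mul`), the three descriptions of the superclasses agree. Through the trace
form, the same reduction shows that the functionals `rootFunctional e` represent the orbits on the
dual space.

Supercharacters. Up to a constant, χ_λ(u) is the average of θ(λ(g · f(u))) over g in UT_n. For λ =
`rootFunctional e` the integrand is a product over the roots (i, j) in D whose factors involve only
rows i and rev j of g. Basicness makes these row pairs disjoint, hence independent, and the average
factors (`expect_prod_of_rows`). Averaging one factor over row rev j is a Fourier inversion that
forces row i of g f(u) to vanish before column j. The result depends only on an initial segment of
row i of g, and UO_n realizes all such segments, so UT_n may be replaced by UO_n. This gives the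
formula for the induced character ξ_(i,j) (`elementaryCharacter_eq_expect`). The constants are
compared by counting the H-orbit (`card_freePositions`).

Supercharacter axioms. Averages over different orbits are orthogonal, and the averages summed over
all λ give a nonzero multiple of the indicator function of 1, so no irreducible character is missed.
That the functions are characters comes from the products of induced characters. -/

theorem isCharacter_of_representation {V : Type*} [AddCommGroup V] [Module ℂ V]
    [FiniteDimensional ℂ V] (ρ : Representation ℂ G V) (hV : 0 < finrank ℂ V) :
    IsCharacter ρ.character := by
  let e : V ≃ₗ[ℂ] (Fin (finrank ℂ V) → ℂ) := (finBasis ℂ V).equivFun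
  refine ⟨finrank ℂ V,
    { toFun := fun g => e.conj (ρ g)
      map_one' := by rw [map_one]; exact LinearEquiv.conj_id e
      map_mul' := fun g h => by rw [map_mul]; exact LinearEquiv.conj_comp e _ _ }, hV, ?_⟩
  funext g
  exact (LinearMap.trace_conj' (ρ g) e).symm

theorem IsCharacter.mul {χ ψ : G → ℂ} (hχ : IsCharacter χ) (hψ : IsCharacter ψ) :
    IsCharacter (χ * ψ) := by
  obtain ⟨d, ρ, hd, rfl⟩ := hχ
  obtain ⟨e, σ, he, rfl⟩ := hψ
  rw [← char_tensor]
  refine isCharacter_of_representation _ ?_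
  rw [finrank_tensorProduct]
  simpa using ⟨hd, he⟩

theorem isCharacter_natCast {m : ℕ} (hm : 0 < m) : IsCharacter fun _ : G => (m : ℂ) :=
  ⟨m, Representation.trivial ℂ G _, hm, by funext g; simp [character]⟩

theorem isCharacter_prod {ι : Type*} (s : Finset ι) {χ : ι → G → ℂ}
    (h : ∀ i ∈ s, IsCharacter (χ i)) : IsCharacter fun g => ∏ i ∈ s, χ i g := by
  classical
  induction s using Finset.induction_on with
  | empty => simpa using isCharacter_natCast (G := G) one_pos
  | insert a s ha ih =>
    simp only [Finset.prod_insert ha]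
    exact (h a (Finset.mem_insert_self a s)).mul
      (ih fun i hi => h i (Finset.mem_insert_of_mem hi))

theorem IsCharacter.natCast_smul {χ : G → ℂ} (hχ : IsCharacter χ) {m : ℕ} (hm : 0 < m) :
    IsCharacter ((m : ℂ) • χ) :=
  (isCharacter_natCast hm).mul hχ

-- Unitarity by averaging: P = ∑ M(g)ᴴ M(g) is positive definite, its summand at 1 being the
-- identity, and M(g)ᴴ P M(g) = P. Hence M(g⁻¹) = P⁻¹ M(g)ᴴ P has the trace of M(g)ᴴ.
open scoped ComplexOrder Matrix in
theorem star_character [Fintype G] {d : ℕ} (ρ : Representation ℂ G (Fin d → ℂ)) (g : G) :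
    star (ρ.character g) = ρ.character g⁻¹ := by
  classical
  let M : G → Matrix (Fin d) (Fin d) ℂ := fun g => LinearMap.toMatrix' (ρ g)
  have hM : ∀ g h, M (g * h) = M g * M h := fun g h => by
    simp only [M, map_mul, LinearMap.toMatrix'_mul]
  have hM1 : M 1 = 1 := by simp [M]
  have htr : ∀ g, ρ.character g = (M g).trace := fun g => by
    rw [character, ← Matrix.toLin'_toMatrix' (ρ g), Matrix.trace_toLin'_eq]
  let P : Matrix (Fin d) (Fin d) ℂ := ∑ g, (M g)ᴴ * M g
  have hP : P.PosDef := by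
    have : P = (∑ g ∈ Finset.univ.erase 1, (M g)ᴴ * M g) + 1 := by
      rw [show (1 : Matrix (Fin d) (Fin d) ℂ) = (M 1)ᴴ * M 1 by simp [hM1],
        Finset.sum_erase_add _ _ (Finset.mem_univ _)]
    rw [this]
    exact Matrix.PosDef.posSemidef_add
      (Matrix.posSemidef_sum _ fun g _ => Matrix.posSemidef_conjTranspose_mul_self _)
      Matrix.PosDef.one
  have hinv : (M g)ᴴ * P * M g = P := by
    simp only [P, Finset.mul_sum, Finset.sum_mul]
    rw [← Equiv.sum_comp (Equiv.mulRight g) fun x => (M x)ᴴ * M x]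
    refine Finset.sum_congr rfl fun x _ => ?_
    simp only [Equiv.coe_mulRight, hM, Matrix.conjTranspose_mul, mul_assoc]
  have hgg : M g * M g⁻¹ = 1 := by rw [← hM, mul_inv_cancel, hM1]
  have hdet : IsUnit P.det := hP.isUnit.map Matrix.detMonoidHom
  have h1 : M g⁻¹ = P⁻¹ * ((M g)ᴴ * P) := by
    have : (M g)ᴴ * P = P * M g⁻¹ := by
      rw [← mul_one ((M g)ᴴ * P), ← hgg, ← mul_assoc, hinv]
    rw [this, ← mul_assoc, Matrix.nonsing_inv_mul _ hdet, one_mul]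
  rw [htr, htr, h1, Matrix.trace_mul_comm, mul_assoc, Matrix.mul_nonsing_inv _ hdet, mul_one,
    Matrix.trace_conjTranspose]

/-- The inner product of two characters is the dimension of a space of intertwining maps. -/
theorem charInner_character [Finite G] {d e : ℕ} (σ : Representation ℂ G (Fin d → ℂ))
    (ρ : Representation ℂ G (Fin e → ℂ)) :
    charInner σ.character ρ.character = finrank ℂ (IntertwiningMap ρ σ) := by
  have := Fintype.ofFinite G
  have : Invertible (Nat.card G : ℂ) := invertibleOfNonzero (by simp)
  rw [← card_inv_mul_sum_char_mul_char_eq_finrank, charInner, finsum_eq_sum_of_fintype]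
  simp only [star_character]

/-- Two characters with a common irreducible constituent are not orthogonal. -/
theorem charInner_ne_zero_of_common [Finite G] {χ χ' ψ : G → ℂ} (hχ : IsCharacter χ)
    (hχ' : IsCharacter χ') (hψ : IsIrredCharacter ψ) (h : charInner χ ψ ≠ 0)
    (h' : charInner χ' ψ ≠ 0) : charInner χ χ' ≠ 0 := by
  obtain ⟨d, σ, -, rfl⟩ := hχ
  obtain ⟨d', σ', -, rfl⟩ := hχ'
  obtain ⟨e, ρ, hρ, rfl⟩ := hψ
  have hsymm : charInner σ'.character ρ.character = star (charInner ρ.character σ'.character) := by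
    have := Fintype.ofFinite G
    simp only [charInner, finsum_eq_sum_of_fintype, star_mul', star_sum, star_star]
    simp [mul_comm]
  rw [hsymm, charInner_character] at h'
  rw [charInner_character] at h ⊢
  have h1 : Nontrivial (IntertwiningMap ρ σ) := by
    by_contra hn
    rw [not_nontrivial_iff_subsingleton] at hn
    exact h (by rw [finrank_zero_of_subsingleton, Nat.cast_zero])
  have h2 : Nontrivial (IntertwiningMap σ' ρ) := by
    by_contra hn
    rw [not_nontrivial_iff_subsingleton] at hn
    exact h' (by rw [finrank_zero_of_subsingleton, Nat.cast_zero, star_zero])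
  obtain ⟨a, ha⟩ := exists_ne (0 : IntertwiningMap ρ σ)
  obtain ⟨b, hb⟩ := exists_ne (0 : IntertwiningMap σ' ρ)
  -- The composite σ' → ρ → σ is nonzero because its first map is onto, ρ being irreducible.
  have hb' : Function.Surjective b :=
    (IsIrreducible.surjective_or_eq_zero b).resolve_right hb
  have hab : a.comp b ≠ 0 := by
    intro h0
    refine ha (DFunLike.ext _ _ fun v => ?_)
    obtain ⟨w, rfl⟩ := hb' v
    exact DFunLike.congr_fun h0 w
  have : Nontrivial (IntertwiningMap σ' σ) := ⟨⟨_, _, hab⟩⟩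
  have : FiniteDimensional ℂ (IntertwiningMap σ' σ) :=
    FiniteDimensional.of_injective
      { toFun := fun f : IntertwiningMap σ' σ => f.toLinearMap
        map_add' := fun _ _ => rfl
        map_smul' := fun _ _ => rfl }
      (IntertwiningMap.toLinearMap_injective σ' σ)
  exact_mod_cast (finrank_pos (R := ℂ) (M := IntertwiningMap σ' σ)).ne'

theorem IsIrredCharacter.apply_one_ne_zero {ψ : G → ℂ} (hψ : IsIrredCharacter ψ) : ψ 1 ≠ 0 := by
  obtain ⟨d, ρ, hρ, rfl⟩ := hψ
  rw [char_one, finrank_fin_fun]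
  rintro h0
  have hd : d = 0 := by exact_mod_cast h0
  subst hd
  have := hρ.toNontrivial
  obtain ⟨a, b, hab⟩ := this
  exact hab (SetLike.ext fun v => by rw [Subsingleton.elim v 0]; exact ⟨fun _ => b.toSubmodule.zero_mem, fun _ => a.toSubmodule.zero_mem⟩)

/-- The class function induced from a linear character of a subgroup is a character. -/
theorem isCharacter_induced [Finite G] (K : Subgroup G) (lam : G → ℂ) (h1 : lam 1 = 1)
    (hmul : ∀ a ∈ K, ∀ b ∈ K, lam (a * b) = lam a * lam b) : IsCharacter (induced K lam) := by
  classical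
  have := Fintype.ofFinite G
  have hK : (Nat.card K : ℂ) ≠ 0 := by simp
  have hinv : ∀ a ∈ K, lam a * lam a⁻¹ = 1 := fun a ha => by
    rw [← hmul a ha _ (K.inv_mem ha), mul_inv_cancel, h1]
  let R : Representation ℂ G (G → ℂ) :=
    { toFun := fun g => LinearMap.funLeft ℂ ℂ fun x => x * g
      map_one' := by ext; simp
      map_mul' := fun g h => by
        refine LinearMap.ext fun φ => funext fun x => ?_
        simp [LinearMap.funLeft_apply, mul_assoc] }
  -- Model of the induced representation: functions that transform by `lam` under left translation
  -- by `K`, with `G` acting by right translation.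
  let W : Submodule ℂ (G → ℂ) :=
    { carrier := {φ | ∀ k ∈ K, ∀ x, φ (k * x) = lam k * φ x}
      zero_mem' := fun k _ x => by simp
      add_mem' := fun ha hb k hk x => by simp only [Pi.add_apply, ha k hk, hb k hk]; ring
      smul_mem' := fun c a ha k hk x => by
        simp only [Pi.smul_apply, ha k hk, smul_eq_mul]; ring }
  have hRW : ∀ g, ∀ φ ∈ W, R g φ ∈ W := fun g φ hφ k hk x => by
    change φ (k * x * g) = lam k * φ (x * g)
    rw [mul_assoc, hφ k hk]
  let ρ : Representation ℂ G W :=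
    { toFun := fun g => (R g).restrict (hRW g)
      map_one' := by ext; simp
      map_mul' := fun g h => by
        refine LinearMap.ext fun φ => Subtype.ext ?_
        change R (g * h) φ = R g (R h φ)
        rw [map_mul]; rfl }
  -- `P` projects onto `W`, so the trace on `W` can be computed on all functions, in the basis of
  -- point masses. The mass at x⁻¹ accounts for the summand at x in `induced`.
  let P : (G → ℂ) →ₗ[ℂ] (G → ℂ) :=
    (Nat.card K : ℂ)⁻¹ • ∑ k : K, lam (k⁻¹ : G) • LinearMap.funLeft ℂ ℂ fun x : G => (k : G) * x
  have hP : ∀ φ x, P φ x = (Nat.card K : ℂ)⁻¹ * ∑ k : K, lam (k⁻¹ : G) * φ (k * x) := by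
    intro φ x
    simp [P, LinearMap.funLeft_apply, LinearMap.sum_apply, Finset.sum_apply]
  have hPW : ∀ φ, P φ ∈ W := fun φ k hk x => by
    rw [hP, hP, mul_left_comm, Finset.mul_sum _ _ (lam k)]
    congr 1
    rw [← Equiv.sum_comp (Equiv.mulRight (⟨k, hk⟩⁻¹ : K))]
    refine Finset.sum_congr rfl fun a _ => ?_
    simp only [Equiv.coe_mulRight, Subgroup.coe_mul, InvMemClass.coe_inv, mul_inv_rev, inv_inv,
      hmul k hk _ (K.inv_mem a.2), mul_assoc, inv_mul_cancel_left]
  have hPid : ∀ φ ∈ W, P φ = φ := fun φ hφ => funext fun x => by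
    rw [hP, Finset.sum_congr rfl fun (k : K) _ => show _ = φ x by
      rw [hφ k k.2, ← mul_assoc, mul_comm (lam _), hinv k k.2, one_mul]]
    rw [Finset.sum_const, Finset.card_univ, nsmul_eq_mul, ← Nat.card_eq_fintype_card, ← mul_assoc,
      inv_mul_cancel₀ hK, one_mul]
  have hchar : ρ.character = induced K lam := by
    funext g
    have ht : LinearMap.trace ℂ W ((P ∘ₗ R g).restrict fun φ _ => hPW (R g φ)) =
        LinearMap.trace ℂ (G → ℂ) (P ∘ₗ R g) :=
      LinearMap.trace_restrict_eq_of_forall_mem W _ fun φ => hPW (R g φ)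
    have hρ : ρ g = (P ∘ₗ R g).restrict fun φ _ => hPW (R g φ) :=
      LinearMap.ext fun φ => Subtype.ext (hPid _ (hRW g φ φ.2)).symm
    rw [character, hρ, ht, LinearMap.trace_eq_matrix_trace ℂ (Pi.basisFun ℂ G), Matrix.trace,
      induced, finsum_eq_sum_of_fintype, Finset.mul_sum, ← Equiv.sum_comp (Equiv.inv G)]
    refine Finset.sum_congr rfl fun x _ => ?_
    rw [Matrix.diag_apply, LinearMap.toMatrix_apply, Pi.basisFun_apply, Pi.basisFun_repr,
      LinearMap.comp_apply, hP]
    congr 1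
    simp only [Equiv.inv_apply]
    have hs : ∀ k : K, R g (Pi.single x⁻¹ 1) (k * x⁻¹) =
        if (k : G) = x⁻¹ * g⁻¹ * x then 1 else 0 := fun k => by
      change (Pi.single x⁻¹ 1 : G → ℂ) (k * x⁻¹ * g) = _
      rw [Pi.single_apply]
      congr 1
      rw [eq_iff_iff, eq_mul_inv_iff_mul_eq.symm, mul_inv_eq_iff_eq_mul]
    simp only [hs]
    by_cases hx : x⁻¹ * g * x ∈ K
    · have hx' : x⁻¹ * g⁻¹ * x ∈ K := by
        have := K.inv_mem hx
        rwa [mul_inv_rev, mul_inv_rev, inv_inv, ← mul_assoc] at this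
      rw [Finset.sum_eq_single (⟨_, hx'⟩ : K)]
      · rw [if_pos rfl, mul_one, Set.indicator_of_mem (by exact hx)]
        congr 1
        group
      · intro k _ hk
        rw [if_neg fun h => hk (Subtype.ext h), mul_zero]
      · simp
    · rw [Set.indicator_of_notMem (by exact hx)]
      refine Finset.sum_eq_zero fun k _ => ?_
      rw [if_neg, mul_zero]
      intro h
      refine hx ?_
      have := K.inv_mem (h ▸ k.2)
      rwa [mul_inv_rev, mul_inv_rev, inv_inv, inv_inv, ← mul_assoc] at this
  rw [← hchar]
  refine isCharacter_of_representation ρ ?_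
  have h0 : ρ.character 1 ≠ 0 := by
    rw [hchar, induced, finsum_eq_sum_of_fintype]
    simp [K.one_mem, h1]
  rw [char_one] at h0
  exact Nat.pos_of_ne_zero fun h => h0 (by rw [h, Nat.cast_zero])

/-- A criterion for supercharacter theories. -/
theorem isSupercharacterTheory_of_orthogonal [Finite G] {K : Set (Set G)} {X : Set (G → ℂ)}
    (hK : Setoid.IsPartition K) (hconj : ∀ S ∈ K, ∀ x ∈ S, ∀ g : G, g * x * g⁻¹ ∈ S)
    (hX : ∀ χ ∈ X, IsCharacter χ) (hcard : X.ncard = K.ncard)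
    (hconst : ∀ χ ∈ X, ∀ S ∈ K, ∀ x ∈ S, ∀ y ∈ S, χ x = χ y)
    (horth : ∀ χ ∈ X, ∀ χ' ∈ X, χ ≠ χ' → charInner χ χ' = 0)
    (hex : ∀ ψ : G → ℂ, IsIrredCharacter ψ → ∃ χ ∈ X, charInner χ ψ ≠ 0) :
    IsSupercharacterTheory K X where
  partition := hK
  conj_mem := hconj
  isCharacter := hX
  card_eq := hcard
  constant := hconst
  constituent ψ hψ := by
    obtain ⟨χ, hχ, h⟩ := hex ψ hψ
    refine ⟨χ, ⟨hχ, h⟩, fun χ' ⟨hχ', h'⟩ => ?_⟩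
    by_contra hne
    exact charInner_ne_zero_of_common (hX _ hχ') (hX _ hχ) hψ h' h (horth _ hχ' _ hχ hne)

end CharacterTheory

/-! ### Congruence of skew matrices under unitriangular matrices -/

section Matrices

variable {n : ℕ} {F : Type*} [Field F]

theorem mat_lower (g : UT n F) {i j : Fin n} (h : j < i) : mat g i j = 0 := g.2.1 i j h

theorem mat_diag (g : UT n F) (i : Fin n) : mat g i i = 1 := g.2.2 i

theorem exists_mat_eq {m : Matrix (Fin n) (Fin n) F} (h : ∀ i j, j < i → m i j = 0)
    (h' : ∀ i, m i i = 1) : ∃ g : UT n F, mat g = m := by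
  have hdet : m.det ≠ 0 := by
    rw [Matrix.det_of_isUpperTriangular fun i j hij => h i j hij]
    simp [h']
  exact ⟨⟨Matrix.GeneralLinearGroup.mkOfDetNeZero m hdet, h, h'⟩, rfl⟩

theorem exists_mat_eq_dagger (g : UT n F) : ∃ g' : UT n F, mat g' = dagger (mat g) :=
  exists_mat_eq (fun i j h => by rw [dagger_apply, mat_lower g (Fin.rev_lt_rev.mpr h)])
    fun i => by rw [dagger_apply, mat_diag]

theorem dagger_sub (x y : Matrix (Fin n) (Fin n) F) : dagger (x - y) = dagger x - dagger y := by
  ext i j; simp [dagger_apply]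

theorem dagger_single (s t : Fin n) (c : F) :
    dagger (Matrix.single s t c) = Matrix.single (Fin.rev t) (Fin.rev s) c := by
  ext i j
  have h : ∀ a b : Fin n, a = Fin.rev b ↔ Fin.rev a = b := fun a b =>
    ⟨fun h => by rw [h, Fin.rev_rev], fun h => by rw [← h, Fin.rev_rev]⟩
  simp only [dagger_apply, Matrix.single_apply, h, and_comm]

theorem skew_apply {x : Matrix (Fin n) (Fin n) F} (hx : dagger x = -x) (i j : Fin n) :
    x (Fin.rev j) (Fin.rev i) = -x i j := by
  rw [← dagger_apply x, hx, Matrix.neg_apply]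

/-- An antidiagonal position is its own mirror image, so skewness says that twice the entry is zero.
-/
theorem skew_antidiag (hF : ringChar F ≠ 2) {x : Matrix (Fin n) (Fin n) F} (hx : dagger x = -x)
    (i : Fin n) : x i (Fin.rev i) = 0 := by
  have h := skew_apply hx i (Fin.rev i)
  rw [Fin.rev_rev, eq_neg_iff_add_eq_zero, ← two_mul] at h
  exact (mul_eq_zero.mp h).resolve_left (Ring.two_ne_zero hF)

theorem skew_congr {x : Matrix (Fin n) (Fin n) F} (hx : dagger x = -x)
    (g : Matrix (Fin n) (Fin n) F) : dagger (g * x * dagger g) = -(g * x * dagger g) := by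
  rw [dagger_mul, dagger_mul, dagger_dagger, hx, neg_mul, mul_neg, mul_assoc]

theorem single_mul_apply_ite (s t : Fin n) (c : F) (y : Matrix (Fin n) (Fin n) F) (k l : Fin n) :
    (Matrix.single s t c * y) k l = if k = s then c * y t l else 0 := by
  split_ifs with h
  · subst h; simp
  · exact Matrix.single_mul_apply_of_ne _ _ _ _ _ h _

theorem mul_single_apply_ite (s t : Fin n) (c : F) (y : Matrix (Fin n) (Fin n) F) (k l : Fin n) :
    (y * Matrix.single s t c) k l = if l = t then y k s * c else 0 := by
  split_ifs with h
  · subst h; simp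
  · exact Matrix.mul_single_apply_of_ne _ _ _ _ _ h _

theorem exists_mat_eq_one_add_single {s t : Fin n} (h : s < t) (c : F) :
    ∃ g : UT n F, mat g = 1 + Matrix.single s t c := by
  refine exists_mat_eq (fun i j hij => ?_) fun i => ?_
  · rw [Matrix.add_apply, Matrix.one_apply_ne hij.ne', Matrix.single_apply, if_neg, add_zero]
    rintro ⟨rfl, rfl⟩
    exact absurd h hij.asymm
  · rw [Matrix.add_apply, Matrix.one_apply_eq, Matrix.single_apply, if_neg, add_zero]
    rintro ⟨rfl, rfl⟩
    exact absurd h (lt_irrefl _)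

/-- A matrix with at most one nonzero entry in each row and in each column. -/
def IsMonomial (e : Matrix (Fin n) (Fin n) F) : Prop :=
  (∀ k l l', e k l ≠ 0 → e k l' ≠ 0 → l = l') ∧ ∀ k k' l, e k l ≠ 0 → e k' l ≠ 0 → k = k'

/-- The entry at (k, l) is the only nonzero one in its column of `e`, so `mat a` does not alter it.
Row k of `e'` agrees with that of `e` before l, hence vanishes there, so `mat b` does not alter the
entry of `e'`. -/
theorem IsMonomial.apply_eq_of_mul_eq {e e' : Matrix (Fin n) (Fin n) F} (he : IsMonomial e)
    (a b : UT n F) {k l : Fin n} (h : (mat a * e) k l = (e' * mat b) k l) (hne : e k l ≠ 0)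
    (hl : ∀ l' < l, e k l' = e' k l') : e k l = e' k l := by
  rw [Matrix.mul_apply, Finset.sum_eq_single k, mat_diag, one_mul, Matrix.mul_apply,
    Finset.sum_eq_single l, mat_diag, mul_one] at h
  · exact h
  · intro m _ hm
    rcases lt_or_gt_of_ne hm with hm | hm
    · rw [← hl m hm]
      by_cases h0 : e k m = 0
      · rw [h0, zero_mul]
      · exact absurd (he.1 _ _ _ h0 hne) hm.ne
    · rw [mat_lower b hm, mul_zero]
  · simp
  · intro m _ hm
    by_cases h0 : e m l = 0
    · rw [h0, mul_zero]
    · exact absurd (he.2 _ _ _ h0 hne) hm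
  · simp

/-- Monomial matrices in the same two-sided orbit of the unitriangular group are equal; it
suffices to compare entries in a region closed under moving down and to the left. -/
theorem IsMonomial.eq_of_mul_mul {e e' : Matrix (Fin n) (Fin n) F} (he : IsMonomial e)
    (he' : IsMonomial e') (a b : UT n F) {R : Fin n → Fin n → Prop}
    (hR : ∀ k l k' l', R k l → k ≤ k' → l' ≤ l → R k' l')
    (h : ∀ k l, R k l → (mat a * e * mat b) k l = e' k l) (k l : Fin n) (hkl : R k l) :
    e k l = e' k l := by
  -- Moving `b`, and below `a`, to the other side only involves entries to the left of or below (k,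
  -- l), which remain in `R`. The comparison is then an induction on the column.
  have h1 : (mat a * e) k l = (e' * mat b⁻¹) k l := by
    rw [← mul_one (mat a * e), ← mat_mul_inv b, ← mul_assoc, Matrix.mul_apply, Matrix.mul_apply]
    refine Finset.sum_congr rfl fun m _ => ?_
    rcases le_or_gt m l with hm | hm
    · rw [h k m (hR _ _ _ _ hkl le_rfl hm)]
    · rw [mat_lower _ hm, mul_zero, mul_zero]
  have h2 : (mat a⁻¹ * e') k l = (e * mat b) k l := by
    rw [← one_mul (e * mat b), ← mat_inv_mul a, mul_assoc (mat a⁻¹), ← mul_assoc (mat a),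
      Matrix.mul_apply, Matrix.mul_apply]
    refine Finset.sum_congr rfl fun m _ => ?_
    rcases le_or_gt k m with hm | hm
    · rw [h m l (hR _ _ _ _ hkl hm le_rfl)]
    · rw [mat_lower _ hm, zero_mul, zero_mul]
  have hl : ∀ l' < l, e k l' = e' k l' := fun l' hl' =>
    IsMonomial.eq_of_mul_mul he he' a b hR h k l' (hR _ _ _ _ hkl le_rfl hl'.le)
  by_cases h0 : e k l = 0
  · by_cases h0' : e' k l = 0
    · rw [h0, h0']
    · exact (he'.apply_eq_of_mul_eq a⁻¹ b h2 h0' fun l' hl' => (hl l' hl').symm).symm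
  · exact he.apply_eq_of_mul_eq a b⁻¹ h1 h0 hl
termination_by l

/-! ### Reduction of skew matrices to monomial form. -/

/-- One elimination step: a multiple of row t is added to row s, together with the mirror column
operation. Call l - k the level of (k, l). As row t vanishes before l, no entry of level at most
that of (s, l) changes, apart from (s, l) and its mirror. -/
theorem skew_kill (hF : ringChar F ≠ 2) {y : Matrix (Fin n) (Fin n) F} (hy : dagger y = -y)
    {s t l : Fin n} (hst : s < t) (ht : y t l ≠ 0) (hs : y s l ≠ 0)
    (hrow : ∀ l' < l, y t l' = 0) :
    ∃ g : UT n F, (mat g * y * dagger (mat g)) s l = 0 ∧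
      (mat g * y * dagger (mat g)) (Fin.rev l) (Fin.rev s) = 0 ∧
      ∀ k l' : Fin n, (l' : ℕ) + s ≤ l + k → (k, l') ≠ (s, l) → (k, l') ≠ (Fin.rev l, Fin.rev s) →
        (mat g * y * dagger (mat g)) k l' = y k l' := by
  obtain ⟨g, hg⟩ := exists_mat_eq_one_add_single hst (-(y s l) / y t l)
  -- The quadratic term of the congruence has the antidiagonal entry y t (rev t) as a factor, so it
  -- vanishes.
  have hexp : ∀ k l', (mat g * y * dagger (mat g)) k l' = y k l' +
      (if k = s then -(y s l) / y t l * y t l' else 0) +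
      (if l' = Fin.rev s then y k (Fin.rev t) * (-(y s l) / y t l) else 0) := by
    intro k l'
    rw [hg, dagger_add, dagger_one, dagger_single, add_mul, one_mul, mul_add, mul_one,
      Matrix.add_apply, Matrix.add_apply, single_mul_apply_ite, mul_single_apply_ite,
      Matrix.add_apply, single_mul_apply_ite, skew_antidiag hF hy]
    simp
  have hne : l ≠ Fin.rev s := by
    rintro rfl
    exact hs (skew_antidiag hF hy s)
  have h0 : (mat g * y * dagger (mat g)) s l = 0 := by
    rw [hexp, if_pos rfl, if_neg hne, div_mul_cancel₀ _ ht]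
    simp
  refine ⟨g, h0, ?_, fun k l' hlev h1 h2 => ?_⟩
  · rw [skew_apply (skew_congr hy (mat g)), h0, neg_zero]
  · rw [hexp]
    have e1 : (if k = s then -(y s l) / y t l * y t l' else 0) = 0 := by
      split_ifs with hk
      · subst hk
        rw [hrow l', mul_zero]
        refine lt_of_le_of_ne (Fin.le_def.mpr (by omega)) ?_
        rintro rfl
        exact h1 rfl
      · rfl
    have e2 : (if l' = Fin.rev s then y k (Fin.rev t) * (-(y s l) / y t l) else 0) = 0 := by
      split_ifs with hk
      · subst hk
        have := skew_apply hy t (Fin.rev k)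
        rw [Fin.rev_rev] at this
        rw [this, hrow (Fin.rev k), neg_zero, zero_mul]
        refine lt_of_le_of_ne (Fin.le_def.mpr ?_) ?_
        · rw [Fin.val_rev] at hlev ⊢
          omega
        · rintro rfl
          exact h2 (by rw [Fin.rev_rev])
      · rfl
    rw [e1, e2, add_zero, add_zero]

/-- The nonzero entry at `(k, l)`, if any, has only zeroes to the left and below. -/
def IsPivotal (y : Matrix (Fin n) (Fin n) F) (k l : Fin n) : Prop :=
  y k l ≠ 0 → (∀ l' < l, y k l' = 0) ∧ ∀ k' > k, y k' l = 0

/-- The number (l + (n - k)) n + k orders positions by level l - k, then by row, since k < n. An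
entry that spoils pivotality at (k, l) lies to the left or below, at a smaller level; it is
therefore already pivotal and can be used to clear (k, l) without disturbing earlier positions. -/
theorem exists_forall_isPivotal (hF : ringChar F ≠ 2) {x : Matrix (Fin n) (Fin n) F}
    (hx : dagger x = -x) (N : ℕ) : ∃ g : UT n F, ∀ k l : Fin n,
      ((l : ℕ) + (n - k)) * n + k < N → IsPivotal (mat g * x * dagger (mat g)) k l := by
  induction N with
  | zero => exact ⟨1, fun k l h => absurd h (Nat.not_lt_zero _)⟩
  | succ N ih =>
    obtain ⟨g, hg⟩ := ih
    set y := mat g * x * dagger (mat g) with hydef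
    have hy : dagger y = -y := skew_congr hx _
    by_cases hall : ∀ k l : Fin n, ((l : ℕ) + (n - k)) * n + k = N → IsPivotal y k l
    · refine ⟨g, fun k l h => ?_⟩
      rcases Nat.lt_succ_iff_lt_or_eq.mp h with h | h
      · exact hg k l h
      · exact hall k l h
    push Not at hall
    obtain ⟨s, l, hN, hbad⟩ := hall
    have hlevel : ∀ k m : Fin n, ((m : ℕ) + (n - k)) * n + k ≤ N → (m : ℕ) + s ≤ l + k := by
      intro k m h
      by_contra hlt
      have h1 : (l : ℕ) + (n - s) + 1 ≤ m + (n - k) := by omega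
      have h2 := Nat.mul_le_mul_right n h1
      rw [add_mul, one_mul] at h2
      omega
    have hless : ∀ k m : Fin n, (m : ℕ) + s < l + k → ((m : ℕ) + (n - k)) * n + k < N := by
      intro k m h
      have h1 : (m : ℕ) + (n - k) + 1 ≤ l + (n - s) := by omega
      have h2 := Nat.mul_le_mul_right n h1
      rw [add_mul, one_mul] at h2
      omega
    have hcode : ∀ k m : Fin n, ((m : ℕ) + (n - k)) * n + k = N → (k, m) = (s, l) := by
      intro k m h
      have h1 := hlevel k m h.le
      have h2 : ¬ (m : ℕ) + s < l + k := fun h' => (hless k m h').ne h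
      have h3 : (m : ℕ) + (n - k) = l + (n - s) := by omega
      rw [h3] at h
      have hk : k = s := Fin.ext (by omega)
      exact Prod.ext hk (Fin.ext (by subst hk; simp at h3 ⊢; omega))
    have key : ∃ h : UT n F, (mat h * y * dagger (mat h)) s l = 0 ∧
        (mat h * y * dagger (mat h)) (Fin.rev l) (Fin.rev s) = 0 ∧
        ∀ k l' : Fin n, (l' : ℕ) + s ≤ l + k → (k, l') ≠ (s, l) → (k, l') ≠ (Fin.rev l, Fin.rev s) →
          (mat h * y * dagger (mat h)) k l' = y k l' := by
      rw [IsPivotal] at hbad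
      push Not at hbad
      obtain ⟨hsl, hbad⟩ := hbad
      by_cases hleft : ∀ l' < l, y s l' = 0
      · obtain ⟨t, hst, ht⟩ := hbad hleft
        exact skew_kill hF hy hst ht hsl (hg t l (hless t l (by omega)) ht).1
      -- An obstruction to the left becomes an obstruction below at the mirror position, so the row
      -- elimination is applied there.
      · push Not at hleft
        obtain ⟨m, hml, hm⟩ := hleft
        obtain ⟨h, h1, h2, h3⟩ := skew_kill hF hy (s := Fin.rev l) (t := Fin.rev m)
          (l := Fin.rev s) (Fin.rev_lt_rev.mpr hml) (by rwa [skew_apply hy, neg_ne_zero])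
          (by rwa [skew_apply hy, neg_ne_zero]) (fun l' hl' => by
            rw [← Fin.rev_rev l', skew_apply hy, neg_eq_zero]
            exact (hg s m (hless s m (by omega)) hm).2 _ (Fin.lt_rev_iff.mpr hl'))
        rw [Fin.rev_rev, Fin.rev_rev] at h2
        refine ⟨h, h2, h1, fun k l' hlev n1 n2 => h3 k l' ?_ n2 ?_⟩
        · rw [Fin.val_rev, Fin.val_rev]; omega
        · rwa [Fin.rev_rev, Fin.rev_rev]
    obtain ⟨h, h1, h2, h3⟩ := key
    refine ⟨h * g, fun k m hkm => ?_⟩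
    have heq : mat (h * g) * x * dagger (mat (h * g)) = mat h * y * dagger (mat h) := by
      rw [mat_mul, dagger_mul, hydef]
      simp only [mul_assoc]
    rw [heq]
    intro hne
    have hlev := hlevel k m (Nat.lt_succ_iff.mp hkm)
    have n1 : (k, m) ≠ (s, l) := fun h' => by
      rw [Prod.mk.injEq] at h'
      rw [h'.1, h'.2] at hne
      exact hne h1
    have n2 : (k, m) ≠ (Fin.rev l, Fin.rev s) := fun h' => by
      rw [Prod.mk.injEq] at h'
      rw [h'.1, h'.2] at hne
      exact hne h2
    have hlow : ∀ k' m' : Fin n, (m' : ℕ) + s < l + k' → y k' m' = 0 →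
        (mat h * y * dagger (mat h)) k' m' = 0 := by
      intro k' m' hlt h0
      rw [h3 k' m' hlt.le, h0]
      · intro h'
        rw [Prod.mk.injEq] at h'
        rw [h'.1, h'.2] at hlt
        exact lt_irrefl _ hlt
      · intro h'
        rw [Prod.mk.injEq] at h'
        rw [h'.1, h'.2, Fin.val_rev, Fin.val_rev] at hlt
        omega
    rw [h3 k m hlev n1 n2] at hne
    have hpiv := hg k m (lt_of_le_of_ne (Nat.lt_succ_iff.mp hkm) fun h' => n1 (hcode k m h')) hne
    exact ⟨fun m' hm' => hlow _ _ (by omega) (hpiv.1 m' hm'),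
      fun k' hk' => hlow _ _ (by omega) (hpiv.2 k' hk')⟩

/-- Every skew matrix is congruent to a monomial one. -/
theorem exists_isMonomial_congr (hF : ringChar F ≠ 2) {x : Matrix (Fin n) (Fin n) F}
    (hx : dagger x = -x) : ∃ g : UT n F, IsMonomial (mat g * x * dagger (mat g)) := by
  obtain ⟨g, hg⟩ := exists_forall_isPivotal hF hx ((n + n) * n + n)
  have hall : ∀ k l, IsPivotal (mat g * x * dagger (mat g)) k l := fun k l => by
    refine hg k l ?_
    have h1 : (l : ℕ) + (n - k) ≤ n + n := by omega
    have := Nat.mul_le_mul_right n h1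
    omega
  refine ⟨g, fun k l l' h h' => ?_, fun k k' l h h' => ?_⟩
  · rcases lt_trichotomy l l' with hlt | rfl | hlt
    · exact absurd ((hall k l' h').1 l hlt) h
    · rfl
    · exact absurd ((hall k l h).1 l' hlt) h'
  · rcases lt_trichotomy k k' with hlt | rfl | hlt
    · exact absurd ((hall k l h).2 k' hlt) h'
    · rfl
    · exact absurd ((hall k' l h').2 k hlt) h

end Matrices

/-! ### Basic elements and orbit representatives -/

section Basics

variable {n : ℕ} {F : Type*} [Field F]

variable (n F) in
/-- The monomial elements of `uo_n`. -/
def basics : Set (Matrix (Fin n) (Fin n) F) := {e | e ∈ uo n F ∧ IsMonomial e}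

open Classical in
/-- The roots at which a matrix is nonzero. -/
noncomputable def rootSet (e : Matrix (Fin n) (Fin n) F) : Finset (Fin n × Fin n) :=
  Finset.univ.filter fun p => p.1 < Fin.rev p.2 ∧ e p.1 p.2 ≠ 0

theorem mem_rootSet {e : Matrix (Fin n) (Fin n) F} {p : Fin n × Fin n} :
    p ∈ rootSet e ↔ p.1 < Fin.rev p.2 ∧ e p.1 p.2 ≠ 0 := by
  simp [rootSet]

theorem mirror_mirror (p : Fin n × Fin n) : mirror (mirror p) = p := by
  simp [mirror]

theorem eq_mirror_comm {p q : Fin n × Fin n} : p = mirror q ↔ q = mirror p :=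
  ⟨fun h => by rw [h, mirror_mirror], fun h => by rw [h, mirror_mirror]⟩

theorem upper_of_ne_zero {x : Matrix (Fin n) (Fin n) F} (hx : x ∈ uo n F) {i j : Fin n}
    (h : x i j ≠ 0) : i < j := by
  by_contra hij
  exact h (hx.1 i j (not_lt.mp hij))

theorem basicElement_apply (D : Finset (Fin n × Fin n)) (φ : Fin n × Fin n → F) (i j : Fin n) :
    basicElement D φ i j = (if (i, j) ∈ D then φ (i, j) else 0) -
      if mirror (i, j) ∈ D then φ (mirror (i, j)) else 0 := by
  rw [basicElement, Finset.sum_sub_distrib, Matrix.sub_apply, Matrix.sum_apply, Matrix.sum_apply]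
  congr 1
  · rw [← Finset.sum_ite_eq' D (i, j) φ]
    refine Finset.sum_congr rfl fun p _ => ?_
    rw [Matrix.single_apply]
    simp only [Prod.ext_iff]
  · rw [← Finset.sum_ite_eq' D (mirror (i, j)) φ]
    refine Finset.sum_congr rfl fun p _ => ?_
    rw [Matrix.single_apply]
    congr 1
    rw [eq_mirror_comm, mirror, Prod.ext_iff, eq_comm (a := i), eq_comm (a := j)]

theorem isBasic_rootSet {e : Matrix (Fin n) (Fin n) F} (he : e ∈ basics n F) :
    IsBasic (rootSet e) := by
  have hne : ∀ p ∈ rootSet e ∪ (rootSet e).image mirror, e p.1 p.2 ≠ 0 := by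
    intro p hp
    rcases Finset.mem_union.mp hp with hp | hp
    · exact (mem_rootSet.mp hp).2
    · obtain ⟨q, hq, rfl⟩ := Finset.mem_image.mp hp
      change e (Fin.rev q.2) (Fin.rev q.1) ≠ 0
      rw [skew_apply he.1.2, neg_ne_zero]
      exact (mem_rootSet.mp hq).2
  refine ⟨fun p hp => ?_, fun p hp p' hp' h => ?_⟩
  · exact ⟨upper_of_ne_zero he.1 (mem_rootSet.mp hp).2, (mem_rootSet.mp hp).1⟩
  · have h1 := hne p hp
    have h2 := hne p' hp'
    rcases h with h | h
    · rw [h] at h1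
      exact Prod.ext h (he.2.1 _ _ _ h1 h2)
    · rw [h] at h1
      exact Prod.ext (he.2.2 _ _ _ h1 h2) h

theorem basicElement_rootSet (hF : ringChar F ≠ 2) {e : Matrix (Fin n) (Fin n) F}
    (he : dagger e = -e) : basicElement (rootSet e) (fun p => e p.1 p.2) = e := by
  ext i j
  have hneg : ∀ k l : Fin n, ¬ k < Fin.rev l → (k, l) ∉ rootSet e := fun k l h h' =>
    h (mem_rootSet.mp h').1
  have hpos : ∀ k l : Fin n, k < Fin.rev l →
      (if (k, l) ∈ rootSet e then e k l else 0) = e k l := fun k l h => by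
    by_cases h0 : e k l = 0
    · rw [h0, ite_self]
    · rw [if_pos (mem_rootSet.mpr ⟨h, h0⟩)]
  rw [basicElement_apply, show mirror (i, j) = (Fin.rev j, Fin.rev i) from rfl]
  rcases lt_trichotomy i (Fin.rev j) with h | h | h
  · rw [if_neg (hneg (Fin.rev j) (Fin.rev i) (by rw [Fin.rev_rev]; exact h.asymm)), hpos _ _ h,
      sub_zero]
  · rw [if_neg (hneg (Fin.rev j) (Fin.rev i) (by rw [Fin.rev_rev]; exact h.not_gt)),
      if_neg (hneg _ _ h.not_lt), sub_zero]
    subst h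
    have := skew_antidiag hF he (Fin.rev j)
    rw [Fin.rev_rev] at this
    exact this.symm
  · rw [if_neg (hneg _ _ h.asymm), hpos _ _ (by rwa [Fin.rev_rev]), zero_sub, skew_apply he,
      neg_neg]

theorem mirror_notMem {D : Finset (Fin n × Fin n)} (hD : ∀ p ∈ D, p.1 < p.2 ∧ p.1 < Fin.rev p.2)
    {p : Fin n × Fin n} (hp : p ∈ D) : mirror p ∉ D := by
  intro h
  have h1 := (hD p hp).2
  have h2 := (hD _ h).2
  simp only [mirror, Fin.rev_rev] at h2
  exact h1.asymm h2

theorem basicElement_apply_of_mem {D : Finset (Fin n × Fin n)}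
    (hD : ∀ p ∈ D, p.1 < p.2 ∧ p.1 < Fin.rev p.2) (φ : Fin n × Fin n → F) {p : Fin n × Fin n}
    (hp : p ∈ D) : basicElement D φ p.1 p.2 = φ p := by
  rw [basicElement_apply, if_pos hp, if_neg (mirror_notMem hD hp), sub_zero]

theorem mem_of_basicElement_ne_zero {D : Finset (Fin n × Fin n)} {φ : Fin n × Fin n → F}
    {i j : Fin n} (h : basicElement D φ i j ≠ 0) : (i, j) ∈ D ∪ D.image mirror := by
  by_contra hn
  rw [Finset.mem_union, not_or, Finset.mem_image] at hn
  rw [basicElement_apply, if_neg hn.1, if_neg fun h' => hn.2 ⟨_, h', mirror_mirror _⟩,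
    sub_zero] at h
  exact h rfl

theorem dagger_basicElement (D : Finset (Fin n × Fin n)) (φ : Fin n × Fin n → F) :
    dagger (basicElement D φ) = -basicElement D φ := by
  ext i j
  rw [dagger_apply, Matrix.neg_apply, basicElement_apply, basicElement_apply,
    show (Fin.rev j, Fin.rev i) = mirror (i, j) from rfl, mirror_mirror, neg_sub]

theorem basicElement_mem_basics {D : Finset (Fin n × Fin n)} (hD : IsBasic D)
    (φ : Fin n × Fin n → F) : basicElement D φ ∈ basics n F := by
  refine ⟨⟨fun i j hij => ?_, dagger_basicElement D φ⟩, fun k l l' h h' => ?_,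
    fun k k' l h h' => ?_⟩
  · by_contra h
    rcases Finset.mem_union.mp (mem_of_basicElement_ne_zero h) with hp | hp
    · exact absurd (hD.1 _ hp).1 (not_lt.mpr hij)
    · obtain ⟨q, hq, hqe⟩ := Finset.mem_image.mp hp
      have := (hD.1 q hq).1
      rw [mirror, Prod.mk.injEq] at hqe
      rw [← hqe.1, ← hqe.2, Fin.rev_le_rev] at hij
      exact absurd this (not_lt.mpr hij)
  · exact congrArg Prod.snd (hD.2 _ (mem_of_basicElement_ne_zero h) _
      (mem_of_basicElement_ne_zero h') (Or.inl rfl))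
  · exact congrArg Prod.fst (hD.2 _ (mem_of_basicElement_ne_zero h) _
      (mem_of_basicElement_ne_zero h') (Or.inr rfl))

theorem rootSet_basicElement {D : Finset (Fin n × Fin n)} (hD : IsBasic D)
    {φ : Fin n × Fin n → F} (hφ : ∀ p ∈ D, φ p ≠ 0) : rootSet (basicElement D φ) = D := by
  ext p
  rw [mem_rootSet]
  constructor
  · rintro ⟨h, h'⟩
    rw [basicElement_apply] at h'
    by_contra hp
    rw [if_neg hp] at h'
    by_cases hm : mirror (p.1, p.2) ∈ D
    · have := (hD.1 _ hm).2
      simp only [mirror, Fin.rev_rev] at this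
      exact h.asymm this
    · rw [if_neg hm, sub_zero] at h'
      exact h' rfl
  · intro hp
    refine ⟨(hD.1 p hp).2, ?_⟩
    rw [basicElement_apply_of_mem hD.1 φ hp]
    exact hφ p hp

/-- Sets indexed by pairs `(D, φ)` are indexed by the monomial elements of `uo_n`. -/
theorem setOf_isBasic_eq_image {α : Type*}
    (Φ : Finset (Fin n × Fin n) → (Fin n × Fin n → F) → α)
    (hΦ : ∀ D φ φ', (∀ p ∈ D, φ p = φ' p) → Φ D φ = Φ D φ') :
    {a | ∃ D φ, IsBasic D ∧ (∀ p ∈ D, φ p ≠ 0) ∧ a = Φ D φ} =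
      (fun e => Φ (rootSet e) fun p => e p.1 p.2) '' basics n F := by
  ext a
  constructor
  · rintro ⟨D, φ, hD, hφ, rfl⟩
    refine ⟨basicElement D φ, basicElement_mem_basics hD φ, ?_⟩
    simp only [rootSet_basicElement hD hφ]
    exact hΦ _ _ _ fun p hp => basicElement_apply_of_mem hD.1 φ hp
  · rintro ⟨e, he, rfl⟩
    exact ⟨_, _, isBasic_rootSet he, fun p hp => (mem_rootSet.mp hp).2, rfl⟩

/-! ### Orbits on `uo_n` -/

theorem act_coe (g : UT n F) (x : uo n F) :
    (act g x : Matrix (Fin n) (Fin n) F) = mat g * x * dagger (mat g) := rfl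

theorem act_mul (g h : UT n F) (x : uo n F) : act (g * h) x = act g (act h x) :=
  Subtype.ext (by simp only [act_coe, mat_mul, dagger_mul, mul_assoc])

theorem act_one (x : uo n F) : act 1 x = x :=
  Subtype.ext (by simp only [act_coe, mat_one, dagger_one, mul_one, one_mul])

theorem act_inv_act (g : UT n F) (x : uo n F) : act g⁻¹ (act g x) = x := by
  rw [← act_mul, inv_mul_cancel, act_one]

theorem act_act_inv (g : UT n F) (x : uo n F) : act g (act g⁻¹ x) = x := by
  rw [← act_mul, mul_inv_cancel, act_one]

theorem exists_basics_act (hF : ringChar F ≠ 2) (x : uo n F) :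
    ∃ (e : uo n F) (g : UT n F), (e : Matrix (Fin n) (Fin n) F) ∈ basics n F ∧ x = act g e := by
  obtain ⟨g, hg⟩ := exists_isMonomial_congr hF x.2.2
  exact ⟨act g x, g⁻¹, ⟨(act g x).2, hg⟩, (act_inv_act g x).symm⟩

theorem basics_eq_of_mul_mul {e e' : Matrix (Fin n) (Fin n) F} (he : e ∈ basics n F)
    (he' : e' ∈ basics n F) (a b : UT n F) (h : mat a * e * mat b = e') : e = e' := by
  ext k l
  exact he.2.eq_of_mul_mul he'.2 a b (R := fun _ _ => True) (fun _ _ _ _ _ _ _ => trivial)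
    (fun k l _ => by rw [h]) k l trivial

/-- Two elements of `uo_n` in the same two-sided orbit are congruent. -/
theorem exists_act_of_mul_mul (hF : ringChar F ≠ 2) (x y : uo n F) (a b : UT n F)
    (h : (y : Matrix (Fin n) (Fin n) F) = mat a * x * mat b) : ∃ g : UT n F, y = act g x := by
  obtain ⟨e, g, he, rfl⟩ := exists_basics_act hF x
  obtain ⟨e', g', he', rfl⟩ := exists_basics_act hF y
  obtain ⟨d, hd⟩ := exists_mat_eq_dagger g
  obtain ⟨d', hd'⟩ := exists_mat_eq_dagger g'⁻¹
  -- Both monomial representatives lie in one two-sided orbit, hence are equal; `x` and `y` are then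
  -- congruent through this common representative.
  have : e = e' := Subtype.ext <| basics_eq_of_mul_mul he he' (g'⁻¹ * a * g) (d * b * d') (by
    have h2 : dagger (mat g') * dagger (mat g'⁻¹) = 1 := by
      rw [← dagger_mul, mat_inv_mul, dagger_one]
    calc mat (g'⁻¹ * a * g) * (e : Matrix (Fin n) (Fin n) F) * mat (d * b * d')
        = mat g'⁻¹ * (mat a * (mat g * e * dagger (mat g)) * mat b) * dagger (mat g'⁻¹) := by
          simp only [mat_mul, hd, hd', mul_assoc]
      _ = mat g'⁻¹ * (mat g' * e' * dagger (mat g')) * dagger (mat g'⁻¹) := by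
          rw [← act_coe g e, ← h, act_coe]
      _ = (mat g'⁻¹ * mat g') * e' * (dagger (mat g') * dagger (mat g'⁻¹)) := by
          simp only [mul_assoc]
      _ = e' := by rw [mat_inv_mul, h2, one_mul, mul_one])
  subst this
  exact ⟨g' * g⁻¹, by rw [act_mul, act_inv_act]⟩

/-! ### Orbits on the dual of `uo_n` -/

/-- The functional `x ↦ tr (z x)` on `uo_n`. -/
def traceFunctional (z : Matrix (Fin n) (Fin n) F) : Module.Dual F (uo n F) where
  toFun x := (z * (x : Matrix (Fin n) (Fin n) F)).trace
  map_add' x y := by simp [mul_add]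
  map_smul' c x := by simp

theorem traceFunctional_apply (z : Matrix (Fin n) (Fin n) F) (x : uo n F) :
    traceFunctional z x = (z * (x : Matrix (Fin n) (Fin n) F)).trace := rfl

/-- By cyclicity of the trace the dual action is again a congruence, by `dagger (mat g)`, so the
reduction of skew matrices also applies to functionals. -/
theorem traceFunctional_comp_act (z : Matrix (Fin n) (Fin n) F) (g : UT n F) :
    traceFunctional z ∘ₗ act g = traceFunctional (dagger (mat g) * z * mat g) := by
  ext x
  change (z * (mat g * x * dagger (mat g))).trace = (dagger (mat g) * z * mat g * x).trace
  rw [← mul_assoc, ← mul_assoc, Matrix.trace_mul_comm]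
  simp only [mul_assoc]

theorem traceFunctional_congr {z z' : Matrix (Fin n) (Fin n) F}
    (h : ∀ i j, j < i → z i j = z' i j) : traceFunctional z = traceFunctional z' := by
  ext x
  simp only [traceFunctional_apply, Matrix.trace, Matrix.diag_apply, Matrix.mul_apply]
  refine Finset.sum_congr rfl fun i _ => Finset.sum_congr rfl fun j _ => ?_
  rcases lt_or_ge j i with hij | hij
  · rw [h i j hij]
  · rw [x.2.1 j i hij, mul_zero, mul_zero]

theorem trace_mul_single (z : Matrix (Fin n) (Fin n) F) (a b : Fin n) (c : F) :
    (z * Matrix.single a b c).trace = z b a * c := by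
  rw [Matrix.trace, Finset.sum_eq_single b]
  · simp
  · intro k _ hk
    rw [Matrix.diag_apply, mul_single_apply_ite, if_neg hk]
  · simp

/-- Evaluating at the skew element supported at (j, i) and its mirror gives 2 z i j. -/
theorem lower_eq_of_traceFunctional_eq (hF : ringChar F ≠ 2) {z z' : Matrix (Fin n) (Fin n) F}
    (hz : dagger z = -z) (hz' : dagger z' = -z')
    (h : traceFunctional z = traceFunctional z') (i j : Fin n) (hij : j < i) :
    z i j = z' i j := by
  have hx : Matrix.single j i (1 : F) - Matrix.single (Fin.rev i) (Fin.rev j) 1 ∈ uo n F := by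
    refine ⟨fun k l hkl => ?_, ?_⟩
    · rw [Matrix.sub_apply, Matrix.single_apply, Matrix.single_apply, if_neg, if_neg, sub_zero]
      · rintro ⟨rfl, rfl⟩
        exact absurd (Fin.rev_le_rev.mp hkl) (not_le.mpr hij)
      · rintro ⟨rfl, rfl⟩
        exact absurd hkl (not_le.mpr hij)
    · rw [dagger_sub, dagger_single, dagger_single, Fin.rev_rev, Fin.rev_rev, neg_sub]
  have h1 := LinearMap.congr_fun h ⟨_, hx⟩
  simp only [traceFunctional_apply, mul_sub, Matrix.trace_sub, trace_mul_single, skew_apply hz,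
    skew_apply hz', mul_one, sub_neg_eq_add, ← two_mul] at h1
  exact mul_left_cancel₀ (Ring.two_ne_zero hF) h1

/-- Extend `lam` to all matrices, represent it by the trace form, and take the skew part; the
symmetric part pairs to zero with `uo n F`. -/
theorem exists_traceFunctional_eq (hF : ringChar F ≠ 2) (lam : Module.Dual F (uo n F)) :
    ∃ z : Matrix (Fin n) (Fin n) F, dagger z = -z ∧ lam = traceFunctional z := by
  obtain ⟨L, hL⟩ := LinearMap.exists_extend lam
  let y : Matrix (Fin n) (Fin n) F := Matrix.of fun i j => L (Matrix.single j i 1)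
  have hLy : ∀ x, L x = (y * x).trace := by
    intro x
    conv_lhs => rw [Matrix.matrix_eq_sum_single x]
    rw [Matrix.trace]
    simp only [map_sum, Matrix.diag_apply, Matrix.mul_apply]
    rw [Finset.sum_comm]
    refine Finset.sum_congr rfl fun i _ => Finset.sum_congr rfl fun j _ => ?_
    rw [← mul_one (x j i), ← smul_eq_mul, ← Matrix.smul_single, map_smul, smul_eq_mul, smul_eq_mul,
      mul_comm, mul_one]
    rfl
  have htr : ∀ x : Matrix (Fin n) (Fin n) F, (dagger x).trace = x.trace := fun x => by
    rw [Matrix.trace, Matrix.trace, ← Equiv.sum_comp Fin.revPerm]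
    exact Finset.sum_congr rfl fun i _ => by simp [dagger_apply]
  have h2 := Ring.two_ne_zero hF
  refine ⟨(2 : F)⁻¹ • (y - dagger y), ?_, ?_⟩
  · rw [dagger_smul, dagger_sub, dagger_dagger, ← smul_neg, neg_sub]
  · ext x
    have h3 : (dagger y * (x : Matrix (Fin n) (Fin n) F)).trace = -(y * x).trace := by
      rw [← htr, dagger_mul, dagger_dagger, x.2.2, Matrix.trace_mul_comm, mul_neg,
        Matrix.trace_neg]
    rw [← hL, traceFunctional_apply, LinearMap.comp_apply, Submodule.subtype_apply, hLy,
      smul_mul_assoc, Matrix.trace_smul, sub_mul, Matrix.trace_sub, h3, sub_neg_eq_add, ← two_mul,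
      smul_eq_mul, inv_mul_cancel_left₀ h2]

/-- The functional `x ↦ ∑ e_p x_p` on `uo_n`, summed over the roots `p` with `e_p ≠ 0`. -/
noncomputable def rootFunctional (e : Matrix (Fin n) (Fin n) F) : Module.Dual F (uo n F) where
  toFun x := ∑ p ∈ rootSet e, e p.1 p.2 * (x : Matrix (Fin n) (Fin n) F) p.1 p.2
  map_add' x y := by simp [mul_add, Finset.sum_add_distrib]
  map_smul' c x := by simp [Finset.mul_sum, mul_left_comm]

theorem rootFunctional_apply (e : Matrix (Fin n) (Fin n) F) (x : uo n F) :
    rootFunctional e x =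
      ∑ p ∈ rootSet e, e p.1 p.2 * (x : Matrix (Fin n) (Fin n) F) p.1 p.2 := rfl

theorem rootFunctional_smul (c : F) (hc : c ≠ 0) (e : Matrix (Fin n) (Fin n) F) :
    rootFunctional (c • e) = c • rootFunctional e := by
  have h : rootSet (c • e) = rootSet e := by
    ext p
    simp [mem_rootSet, hc]
  ext x
  rw [LinearMap.smul_apply, rootFunctional_apply, rootFunctional_apply, h, smul_eq_mul,
    Finset.mul_sum]
  exact Finset.sum_congr rfl fun p _ => by rw [Matrix.smul_apply, smul_eq_mul, mul_assoc]

theorem smul_mem_basics (c : F) {e : Matrix (Fin n) (Fin n) F}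
    (he : e ∈ basics n F) : c • e ∈ basics n F := by
  refine ⟨(uo n F).smul_mem c he.1, fun k l l' h h' => he.2.1 k l l' ?_ ?_,
    fun k k' l h h' => he.2.2 k k' l ?_ ?_⟩
  all_goals
    intro h0
    simp [h0] at h h'

/-- A root and its mirror contribute equally to the trace, whence the factor 1/2. -/
theorem rootFunctional_eq_traceFunctional (hF : ringChar F ≠ 2) {e : Matrix (Fin n) (Fin n) F}
    (he : dagger e = -e) :
    rootFunctional e = traceFunctional ((2 : F)⁻¹ • e.transpose) := by
  ext x
  have h2 := Ring.two_ne_zero hF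
  conv_rhs => rw [← basicElement_rootSet hF he]
  rw [rootFunctional_apply, traceFunctional_apply, smul_mul_assoc, Matrix.trace_smul, smul_eq_mul,
    basicElement, Matrix.transpose_sum, Finset.sum_mul, Matrix.trace_sum, Finset.mul_sum]
  refine Finset.sum_congr rfl fun p _ => ?_
  rw [Matrix.transpose_sub, Matrix.transpose_single, Matrix.transpose_single, sub_mul,
    Matrix.trace_sub, Matrix.trace_mul_comm, trace_mul_single, Matrix.trace_mul_comm,
    trace_mul_single, skew_apply x.2.2, neg_mul, sub_neg_eq_add, ← two_mul,
    inv_mul_cancel_left₀ h2, mul_comm]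

theorem dagger_transpose (x : Matrix (Fin n) (Fin n) F) :
    dagger x.transpose = (dagger x).transpose := by
  ext i j
  rw [dagger_apply, Matrix.transpose_apply, Matrix.transpose_apply, dagger_apply]

theorem exists_rootFunctional_comp_act (hF : ringChar F ≠ 2) (lam : Module.Dual F (uo n F)) :
    ∃ (e : Matrix (Fin n) (Fin n) F) (g : UT n F), e ∈ basics n F ∧
      lam = rootFunctional e ∘ₗ act g := by
  have h2 := Ring.two_ne_zero hF
  obtain ⟨z, hz, rfl⟩ := exists_traceFunctional_eq hF lam
  obtain ⟨g, hg⟩ := exists_isMonomial_congr hF hz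
  obtain ⟨d, hd⟩ := exists_mat_eq_dagger g
  have hskew := skew_congr hz (mat g)
  set z' := mat g * z * dagger (mat g) with hz'
  -- The functional sees only the strictly lower part of `z'`. Transposing this part puts it into
  -- `uo n F`, and the 2 cancels the 1/2 of `rootFunctional_eq_traceFunctional`.
  let e : Matrix (Fin n) (Fin n) F := Matrix.of fun k l => if k < l then 2 * z' l k else 0
  have heval : ∀ k l, e k l = if k < l then 2 * z' l k else 0 := fun k l => rfl
  have hne : ∀ k l, e k l ≠ 0 → z' l k ≠ 0 := fun k l h h0 => h (by simp [heval, h0])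
  have heskew : dagger e = -e := by
    ext k l
    rw [dagger_apply, Matrix.neg_apply, heval, heval, skew_apply hskew]
    simp only [Fin.rev_lt_rev]
    split_ifs <;> simp
  refine ⟨e, d⁻¹, ⟨⟨fun i j hij => if_neg (not_lt.mpr hij), heskew⟩,
    fun k l l' h h' => hg.2 _ _ _ (hne _ _ h) (hne _ _ h'),
    fun k k' l h h' => hg.1 _ _ _ (hne _ _ h) (hne _ _ h')⟩, ?_⟩
  have h3 : rootFunctional e = traceFunctional z ∘ₗ act d := by
    rw [rootFunctional_eq_traceFunctional hF heskew, traceFunctional_comp_act, hd, dagger_dagger,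
      ← hz']
    refine traceFunctional_congr fun i j hij => ?_
    rw [Matrix.smul_apply, Matrix.transpose_apply, heval, if_pos hij, smul_eq_mul,
      inv_mul_cancel_left₀ h2]
  rw [h3]
  ext x
  simp only [LinearMap.comp_apply, act_act_inv]

/-- Equality of functionals controls only strictly lower entries. These form a region closed
downwards and to the left, which is why `IsMonomial.eq_of_mul_mul` is stated relative to a region.
-/
theorem rootFunctional_orbit_injective (hF : ringChar F ≠ 2) {e e' : Matrix (Fin n) (Fin n) F}
    (he : e ∈ basics n F) (he' : e' ∈ basics n F) {g : UT n F}
    (h : rootFunctional e' = rootFunctional e ∘ₗ act g) : e = e' := by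
  have h2 := inv_ne_zero (Ring.two_ne_zero hF)
  obtain ⟨d, hd⟩ := exists_mat_eq_dagger g
  have hsk : ∀ {e : Matrix (Fin n) (Fin n) F}, e ∈ basics n F →
      dagger ((2 : F)⁻¹ • e.transpose) = -((2 : F)⁻¹ • e.transpose) := fun he => by
    rw [dagger_smul, dagger_transpose, he.1.2, Matrix.transpose_neg, smul_neg]
  rw [rootFunctional_eq_traceFunctional hF he.1.2, rootFunctional_eq_traceFunctional hF he'.1.2,
    traceFunctional_comp_act] at h
  have hlow := lower_eq_of_traceFunctional_eq hF (hsk he') (by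
    have := skew_congr (hsk he) (dagger (mat g))
    rwa [dagger_dagger] at this) h
  have hmon : ∀ {e : Matrix (Fin n) (Fin n) F}, e ∈ basics n F → IsMonomial e.transpose :=
    fun he => ⟨fun k l l' h h' => he.2.2 _ _ _ h h', fun k k' l h h' => he.2.1 _ _ _ h h'⟩
  ext k l
  rcases lt_or_ge k l with hkl | hkl
  · refine (hmon he).eq_of_mul_mul (hmon he') d g (R := fun k l => l < k)
      (fun _ _ _ _ h1 h2 h3 => h3.trans_lt (h1.trans_le h2)) (fun k l hkl => ?_) l k hkl
    have := hlow k l hkl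
    rw [mul_smul_comm, smul_mul_assoc, Matrix.smul_apply, Matrix.smul_apply, smul_eq_mul,
      smul_eq_mul] at this
    rw [hd]
    exact (mul_left_cancel₀ h2 this).symm
  · rw [he.1.1 k l hkl, he'.1.1 k l hkl]

/-! ### Springer morphisms and superclasses -/

theorem onUO_coe (f : SpringerMorphism n F) (u : UO n F) :
    (f.onUO u : Matrix (Fin n) (Fin n) F) = f.toFun u := rfl

theorem onUO_bijective (f : SpringerMorphism n F) : Function.Bijective f.onUO := by
  refine ⟨fun u v h => Subtype.ext (f.injective (congrArg Subtype.val h)), fun x => ?_⟩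
  have h : (x : Matrix (Fin n) (Fin n) F) ∈ f.toFun '' (UO n F : Set (UT n F)) := by
    rw [f.image_UO]; exact x.2
  obtain ⟨u, hu, hux⟩ := h
  exact ⟨⟨u, hu⟩, Subtype.ext hux⟩

theorem mat_sub_one_apply (g : UT n F) {i j : Fin n} (h : j ≤ i) : (mat g - 1) i j = 0 := by
  rw [Matrix.sub_apply]
  rcases h.lt_or_eq with h | rfl
  · rw [mat_lower g h, Matrix.one_apply_ne h.ne', sub_zero]
  · rw [mat_diag, Matrix.one_apply_eq, sub_self]

theorem ut_mul_mem {x y : Matrix (Fin n) (Fin n) F} (hx : x ∈ ut n F)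
    (hy : ∀ i j, j < i → y i j = 0) : x * y ∈ ut n F := fun i j hij => by
  rw [Matrix.mul_apply]
  refine Finset.sum_eq_zero fun k _ => ?_
  rcases le_or_gt k i with hk | hk
  · rw [hx i k hk, zero_mul]
  · rw [hy k j (hij.trans_lt hk), mul_zero]

theorem exists_mat_eq_one_add {x : Matrix (Fin n) (Fin n) F} (hx : x ∈ ut n F) :
    ∃ g : UT n F, mat g = 1 + x :=
  exists_mat_eq (fun i j h => by rw [Matrix.add_apply, Matrix.one_apply_ne h.ne', hx i j h.le,
    add_zero]) fun i => by rw [Matrix.add_apply, Matrix.one_apply_eq, hx i i le_rfl, add_zero]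

/-- Factoring u - 1 out of the polynomial leaves 1 + ∑ a_i (u - 1)^(i-1), which is unitriangular.
Thus f(u) and u - 1 lie in one two-sided orbit. -/
theorem exists_springer_eq_mul (f : SpringerMorphism n F) (u : UT n F) :
    ∃ w : UT n F, f.toFun u = (mat u - 1) * mat w := by
  obtain ⟨a, ha⟩ := f.exists_coeff
  have hu : mat u - 1 ∈ ut n F := fun i j h => mat_sub_one_apply u h
  have hpow : ∀ i : ℕ, 2 ≤ i → (mat u - 1) ^ (i - 1) ∈ ut n F := by
    intro i hi
    induction i, hi using Nat.le_induction with
    | base => simpa using hu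
    | succ k hk ih =>
      rw [show k + 1 - 1 = (k - 1) + 1 by omega, pow_succ]
      exact ut_mul_mem ih fun i j h => hu i j h.le
  obtain ⟨w, hw⟩ := exists_mat_eq_one_add (Submodule.sum_mem (ut n F) fun i
    (hi : i ∈ Finset.Ico 2 n) => (ut n F).smul_mem (a i) (hpow i (Finset.mem_Ico.mp hi).1))
  refine ⟨w, ?_⟩
  rw [ha, hw, mul_add, mul_one, Finset.mul_sum]
  congr 1
  refine Finset.sum_congr rfl fun i hi => ?_
  rw [mul_smul_comm, ← pow_succ', show i - 1 + 1 = i by have := (Finset.mem_Ico.mp hi).1; omega]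

theorem springer_conj (f : SpringerMorphism n F) (g u : UT n F) :
    f.toFun (g * u * g⁻¹) = mat g * f.toFun u * mat g⁻¹ := by
  obtain ⟨a, ha⟩ := f.exists_coeff
  have h1 : mat (g * u * g⁻¹) - 1 = mat g * (mat u - 1) * mat g⁻¹ := by
    rw [mul_sub, sub_mul, mul_one, mat_mul_inv, mat_mul, mat_mul]
  have hpow : ∀ i : ℕ, (mat g * (mat u - 1) * mat g⁻¹) ^ i =
      mat g * (mat u - 1) ^ i * mat g⁻¹ := by
    intro i
    induction i with
    | zero => rw [pow_zero, pow_zero, mul_one, mat_mul_inv]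
    | succ k ih =>
      rw [pow_succ, ih, pow_succ]
      calc mat g * (mat u - 1) ^ k * mat g⁻¹ * (mat g * (mat u - 1) * mat g⁻¹)
          = mat g * (mat u - 1) ^ k * (mat g⁻¹ * mat g) * (mat u - 1) * mat g⁻¹ := by
            simp only [mul_assoc]
        _ = _ := by rw [mat_inv_mul, mul_one]; simp only [mul_assoc]
  rw [ha, ha, h1, mul_add, add_mul, Finset.mul_sum, Finset.sum_mul]
  congr 1
  refine Finset.sum_congr rfl fun i _ => ?_
  rw [hpow, mul_smul_comm, smul_mul_assoc]

/-- A polynomial map commutes with conjugation, and g⁻¹ = g† on `UO n F`. Hence superclasses are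
unions of conjugacy classes. -/
theorem onUO_conj (f : SpringerMorphism n F) (g u : UO n F) :
    f.onUO (g * u * g⁻¹) = act (g : UT n F) (f.onUO u) := by
  refine Subtype.ext ?_
  rw [onUO_coe, act_coe, onUO_coe, Subgroup.coe_mul, Subgroup.coe_mul, Subgroup.coe_inv,
    springer_conj, show mat (g : UT n F)⁻¹ = _ from g.2]

/-- Congruence of `f(v)` and `f(u)` amounts to `v - 1` lying in the two-sided orbit of `u - 1`. -/
theorem mem_superclass_iff (hF : ringChar F ≠ 2) (f : SpringerMorphism n F) (u v : UO n F) :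
    v ∈ superclass f u ↔ (v : UT n F) ∈ algSuperclass (u : UT n F) := by
  obtain ⟨w, hw⟩ := exists_springer_eq_mul f u
  obtain ⟨w', hw'⟩ := exists_springer_eq_mul f v
  constructor
  · rintro ⟨g, hg⟩
    obtain ⟨d, hd⟩ := exists_mat_eq_dagger g
    have h := congrArg Subtype.val hg
    rw [act_coe, onUO_coe, onUO_coe, hw, hw'] at h
    refine ⟨g, w * d * w'⁻¹, ?_⟩
    calc mat (v : UT n F) - 1 = (mat (v : UT n F) - 1) * (mat w' * mat w'⁻¹) := by
          rw [mat_mul_inv, mul_one]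
      _ = _ := by rw [← mul_assoc, h]; simp only [mat_mul, hd, mul_assoc]
  · rintro ⟨a, b, hab⟩
    refine exists_act_of_mul_mul hF _ _ a (w⁻¹ * b * w') ?_
    rw [onUO_coe, onUO_coe, hw, hw', hab]
    calc mat a * (mat (u : UT n F) - 1) * mat b * mat w'
        = mat a * ((mat (u : UT n F) - 1) * (mat w * mat w⁻¹)) * mat b * mat w' := by
          rw [mat_mul_inv, mul_one]
      _ = _ := by simp only [mat_mul, mul_assoc]

theorem superclass_eq_of_mem {f : SpringerMorphism n F} {u v : UO n F} (h : v ∈ superclass f u) :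
    superclass f v = superclass f u := by
  obtain ⟨g, hg⟩ := h
  ext w
  constructor
  · rintro ⟨k, hk⟩
    exact ⟨k * g, by rw [hk, hg, act_mul]⟩
  · rintro ⟨k, hk⟩
    exact ⟨k * g⁻¹, by rw [hk, hg, act_mul, act_inv_act]⟩

theorem mem_superclass_self (f : SpringerMorphism n F) (u : UO n F) : u ∈ superclass f u :=
  ⟨1, (act_one _).symm⟩

theorem isPartition_superclasses (f : SpringerMorphism n F) :
    Setoid.IsPartition (superclasses f) := by
  refine ⟨?_, fun u => ⟨superclass f u, ⟨⟨u, rfl⟩, mem_superclass_self f u⟩, ?_⟩⟩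
  · rintro ⟨u, hu⟩
    have := mem_superclass_self f u
    rw [hu] at this
    exact this
  · rintro S ⟨⟨v, rfl⟩, hS⟩
    exact (superclass_eq_of_mem hS).symm

theorem superclasses_eq_algSuperclasses (hF : ringChar F ≠ 2) (f : SpringerMorphism n F) :
    superclasses f = {S | S.Nonempty ∧ ∃ g : UT n F,
      S = {u : UO n F | (u : UT n F) ∈ algSuperclass g}} := by
  ext S
  constructor
  · rintro ⟨u, rfl⟩
    exact ⟨⟨u, mem_superclass_self f u⟩, u, Set.ext fun v => mem_superclass_iff hF f u v⟩
  · rintro ⟨⟨u, hu⟩, g, rfl⟩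
    obtain ⟨a, b, hab⟩ := hu
    refine ⟨u, Set.ext fun v => (mem_superclass_iff hF f u v).trans ?_⟩
    constructor
    · rintro ⟨c, d, hcd⟩
      exact ⟨c * a, b * d, by rw [hcd, hab]; simp only [mat_mul, mul_assoc]⟩
    · rintro ⟨c, d, hcd⟩
      refine ⟨c * a⁻¹, b⁻¹ * d, ?_⟩
      calc mat (v : UT n F) - 1 = mat c * ((mat a⁻¹ * mat a) * (mat g - 1) *
            (mat b * mat b⁻¹)) * mat d := by
            rw [hcd, mat_inv_mul, mat_mul_inv, one_mul, mul_one]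
        _ = mat (c * a⁻¹) * (mat a * (mat g - 1) * mat b) * mat (b⁻¹ * d) := by
            simp only [mat_mul, mul_assoc]
        _ = _ := by rw [hab]

theorem mem_anSuperclass_iff (hF : ringChar F ≠ 2) (f : SpringerMorphism n F) (e : uo n F)
    (D : Finset (Fin n × Fin n)) (φ : Fin n × Fin n → F)
    (he : basicElement D φ = (e : Matrix (Fin n) (Fin n) F)) (u : UO n F) :
    u ∈ anSuperclass D φ ↔ ∃ g : UT n F, f.onUO u = act g e := by
  obtain ⟨w, hw⟩ := exists_springer_eq_mul f u
  constructor
  · rintro ⟨a, b, hab⟩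
    refine exists_act_of_mul_mul hF _ _ a (b * w) ?_
    rw [onUO_coe, hw, hab, he, mat_mul, mul_assoc]
  · rintro ⟨g, hg⟩
    obtain ⟨d, hd⟩ := exists_mat_eq_dagger g
    have h := congrArg Subtype.val hg
    rw [act_coe, onUO_coe, hw] at h
    refine ⟨g, d * w⁻¹, ?_⟩
    calc mat (u : UT n F) - 1 = (mat (u : UT n F) - 1) * (mat w * mat w⁻¹) := by
          rw [mat_mul_inv, mul_one]
      _ = _ := by rw [← mul_assoc, h, he]; simp only [mat_mul, hd, mul_assoc]

/-- The set of `u ∈ UO_n` such that `f(u)` is congruent to `e`. -/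
def congrClass (f : SpringerMorphism n F) (e : Matrix (Fin n) (Fin n) F) : Set (UO n F) :=
  {u | ∃ g : UT n F, (f.onUO u : Matrix (Fin n) (Fin n) F) = mat g * e * dagger (mat g)}

/-- With `congrClass_injOn` this indexes superclasses bijectively by `basics n F`, which also
indexes supercharacters, so the two cardinalities agree. -/
theorem superclasses_eq_image (hF : ringChar F ≠ 2) (f : SpringerMorphism n F) :
    superclasses f = congrClass f '' basics n F := by
  have key : ∀ (e : uo n F) (u : UO n F), f.onUO u = e → superclass f u = congrClass f e := by
    rintro e u rfl
    ext v
    exact exists_congr fun g => Subtype.ext_iff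
  ext S
  constructor
  · rintro ⟨u, rfl⟩
    obtain ⟨e, g, he, hg⟩ := exists_basics_act hF (f.onUO u)
    obtain ⟨v, hv⟩ := (onUO_bijective f).2 e
    refine ⟨e, he, ?_⟩
    rw [← key e v hv]
    exact (superclass_eq_of_mem ⟨g, by rw [hg, hv]⟩).symm
  · rintro ⟨e, he, rfl⟩
    obtain ⟨v, hv⟩ := (onUO_bijective f).2 ⟨e, he.1⟩
    exact ⟨v, key ⟨e, he.1⟩ v hv⟩

theorem congrClass_injOn (f : SpringerMorphism n F) :
    Set.InjOn (congrClass f) (basics n F) := by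
  intro e he e' he' h
  obtain ⟨v, hv⟩ := (onUO_bijective f).2 ⟨e, he.1⟩
  have hmem : v ∈ congrClass f e := ⟨1, by rw [hv, mat_one, dagger_one, one_mul, mul_one]⟩
  rw [h] at hmem
  obtain ⟨g, hg⟩ := hmem
  obtain ⟨d, hd⟩ := exists_mat_eq_dagger g
  rw [hv, ← hd] at hg
  exact (basics_eq_of_mul_mul he' he g d hg.symm).symm

theorem superclasses_eq_anSuperclasses (hF : ringChar F ≠ 2) (f : SpringerMorphism n F) :
    superclasses f = anSuperclasses n F := by
  have h := setOf_isBasic_eq_image (n := n) (anSuperclass (n := n) (F := F))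
    fun D φ φ' hφ => by
      have : basicElement D φ = basicElement D φ' :=
        Finset.sum_congr rfl fun p hp => by rw [hφ p hp]
      rw [anSuperclass, anSuperclass, this]
  rw [anSuperclasses, h, superclasses_eq_image hF f]
  refine Set.image_congr fun e he => Set.ext fun u => ?_
  rw [mem_anSuperclass_iff hF f ⟨e, he.1⟩ _ _ (basicElement_rootSet hF he.1.2)]
  exact exists_congr fun g => ⟨fun h => Subtype.ext h, fun h => congrArg Subtype.val h⟩

end Basics

/-! ### Averages over the unitriangular group -/

section Averages

open scoped BigOperators

variable {n : ℕ} {F : Type*} [Field F]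

theorem exists_mix (s : Finset (Fin n)) (g h : UT n F) :
    ∃ k : UT n F, ∀ i j, mat k i j = if i ∈ s then mat g i j else mat h i j := by
  obtain ⟨k, hk⟩ := exists_mat_eq (m := Matrix.of fun i j => if i ∈ s then mat g i j else mat h i j)
    (fun i j hij => by simp [mat_lower _ hij]) fun i => by simp [mat_diag]
  exact ⟨k, fun i j => by rw [hk]; rfl⟩

/-- The matrix that has the rows of `g` in `s` and the rows of `h` elsewhere. -/
noncomputable def mix (s : Finset (Fin n)) (g h : UT n F) : UT n F := (exists_mix s g h).choose

theorem mat_mix (s : Finset (Fin n)) (g h : UT n F) (i j : Fin n) :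
    mat (mix s g h) i j = if i ∈ s then mat g i j else mat h i j :=
  (exists_mix s g h).choose_spec i j

theorem mix_mix (s : Finset (Fin n)) (g h : UT n F) : mix s (mix s g h) (mix s h g) = g := by
  refine mat_injective ?_
  ext i j
  simp only [mat_mix]
  split_ifs <;> rfl

/-- Disjoint sets of rows of a uniformly distributed unitriangular matrix are independent. -/
theorem expect_diag [Fintype (UT n F)] (s : Finset (Fin n)) (Ω : UT n F → UT n F → ℂ)
    (h₁ : ∀ g g' h, (∀ i ∈ s, mat g i = mat g' i) → Ω g h = Ω g' h)
    (h₂ : ∀ g h h', (∀ i ∉ s, mat h i = mat h' i) → Ω g h = Ω g h') :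
    𝔼 g, Ω g g = 𝔼 g, 𝔼 h, Ω g h := by
  have key : ∀ g h, Ω g h = Ω (mix s g h) (mix s g h) := fun g h => by
    rw [h₁ g (mix s g h) h fun i hi => funext fun j => by rw [mat_mix, if_pos hi],
      h₂ _ h (mix s g h) fun i hi => funext fun j => by rw [mat_mix, if_neg hi]]
  -- The involution on pairs that exchanges the rows outside `s`.
  let e : UT n F × UT n F ≃ UT n F × UT n F :=
    { toFun := fun p => (mix s p.1 p.2, mix s p.2 p.1)
      invFun := fun p => (mix s p.1 p.2, mix s p.2 p.1)
      left_inv := fun p => Prod.ext (mix_mix s _ _) (mix_mix s _ _)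
      right_inv := fun p => Prod.ext (mix_mix s _ _) (mix_mix s _ _) }
  calc 𝔼 g, Ω g g = 𝔼 g, 𝔼 _h : UT n F, Ω g g := by simp
    _ = 𝔼 p : UT n F × UT n F, Ω p.1 p.1 :=
      (Finset.expect_product Finset.univ Finset.univ fun p : UT n F × UT n F => Ω p.1 p.1).symm
    _ = 𝔼 p : UT n F × UT n F, Ω p.1 p.2 :=
      (Fintype.expect_equiv e _ _ fun p => key p.1 p.2).symm
    _ = 𝔼 g, 𝔼 h, Ω g h :=
      Finset.expect_product Finset.univ Finset.univ fun p : UT n F × UT n F => Ω p.1 p.2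

theorem expect_prod_of_rows [Fintype (UT n F)] {ι : Type*} (D : Finset ι) (r : ι → Finset (Fin n))
    (hr : ∀ p ∈ D, ∀ p' ∈ D, p ≠ p' → Disjoint (r p) (r p')) (Φ : ι → UT n F → ℂ)
    (hΦ : ∀ p ∈ D, ∀ g h, (∀ i ∈ r p, mat g i = mat h i) → Φ p g = Φ p h) :
    𝔼 g, ∏ p ∈ D, Φ p g = ∏ p ∈ D, 𝔼 g, Φ p g := by
  classical
  induction D using Finset.induction_on with
  | empty => simp
  | insert a D ha ih =>
    simp only [Finset.prod_insert ha]
    rw [← ih (fun p hp p' hp' => hr p (Finset.mem_insert_of_mem hp) p' (Finset.mem_insert_of_mem hp'))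
      fun p hp => hΦ p (Finset.mem_insert_of_mem hp)]
    rw [expect_diag (r a) fun g h => Φ a g * ∏ p ∈ D, Φ p h]
    · simp only [← Finset.mul_expect, ← Finset.expect_mul]
    · intro g g' h hg
      simp only [hΦ a (Finset.mem_insert_self a D) g g' hg]
    · intro g h h' hh
      congr 1
      refine Finset.prod_congr rfl fun p hp => hΦ p (Finset.mem_insert_of_mem hp) _ _ fun i hi => ?_
      refine hh i fun hi' => ?_
      exact Finset.disjoint_left.mp (hr a (Finset.mem_insert_self a D) p
        (Finset.mem_insert_of_mem hp) fun h => ha (h ▸ hp)) hi' hi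

open Classical in
/-- The function `y ↦ θ (r y_ij)` on the matrices `y` whose `i`-th row vanishes before `j`,
extended by zero. -/
noncomputable def rowChar (θ : AddChar F ℂ) (r : F) (i j : Fin n) (y : Matrix (Fin n) (Fin n) F) :
    ℂ :=
  if ∀ l < j, y i l = 0 then θ (r * y i j) else 0

theorem rowChar_congr (θ : AddChar F ℂ) (r : F) {i j : Fin n} {y y' : Matrix (Fin n) (Fin n) F}
    (h : ∀ l ≤ j, y i l = y' i l) : rowChar θ r i j y = rowChar θ r i j y' := by
  rw [rowChar, rowChar, h j le_rfl]
  congr 1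
  exact propext ⟨fun h' l hl => (h l hl.le).symm.trans (h' l hl),
    fun h' l hl => (h l hl.le).trans (h' l hl)⟩

theorem mul_mat_apply_of_zero {i j : Fin n} {y : Matrix (Fin n) (Fin n) F} (w : UT n F)
    (h : ∀ l < j, y i l = 0) (l : Fin n) (hl : l ≤ j) : (y * mat w) i l = y i l := by
  rw [Matrix.mul_apply, Finset.sum_eq_single l, mat_diag, mul_one]
  · intro m _ hm
    rcases lt_or_gt_of_ne hm with hm | hm
    · rw [h m (hm.trans_le hl), zero_mul]
    · rw [mat_lower w hm, mul_zero]
  · simp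

/-- Right multiplication adds columns only to later columns, so it respects the vanishing before j
and then fixes the entry at j. This absorbs both the factor w in f(u) = (u - 1)w and the x⁻¹ in a
conjugate. -/
theorem rowChar_mul_mat (θ : AddChar F ℂ) (r : F) (i j : Fin n) (y : Matrix (Fin n) (Fin n) F)
    (w : UT n F) : rowChar θ r i j (y * mat w) = rowChar θ r i j y := by
  by_cases h : ∀ l < j, y i l = 0
  · exact rowChar_congr θ r fun l hl => mul_mat_apply_of_zero w h l hl
  · by_cases h' : ∀ l < j, (y * mat w) i l = 0
    · refine absurd (fun l hl => ?_) h
      have := mul_mat_apply_of_zero w⁻¹ h' l hl.le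
      rw [mul_assoc, mat_mul_inv, mul_one, h' l hl] at this
      exact this
    · rw [rowChar, rowChar, if_neg h, if_neg h']

theorem exists_addChar_mul_ne_one {θ : AddChar F ℂ} (hθ : θ ≠ 1) {a : F} (ha : a ≠ 0) :
    ∃ t, θ (a * t) ≠ 1 := by
  obtain ⟨x, hx⟩ := (AddChar.ne_one_iff).mp hθ
  exact ⟨a⁻¹ * x, by rwa [mul_inv_cancel_left₀ ha]⟩

/-- If y i l ≠ 0 for some l < j, translating h by 1 + t e_(rev j, rev l) multiplies the average by
θ(r y_il t), which is not 1 for suitable t, so the average is zero. Otherwise the integrand is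
constant. -/
theorem expect_dagger_mul [Fintype (UT n F)] {θ : AddChar F ℂ} (hθ : θ ≠ 1) {r : F} (hr : r ≠ 0)
    (i j : Fin n) (y : Matrix (Fin n) (Fin n) F) :
    𝔼 h : UT n F, θ (r * (y * dagger (mat h)) i j) = rowChar θ r i j y := by
  rw [rowChar]
  split_ifs with h0
  · have : ∀ h : UT n F, θ (r * (y * dagger (mat h)) i j) = θ (r * y i j) := fun h => by
      obtain ⟨d, hd⟩ := exists_mat_eq_dagger h
      rw [← hd, mul_mat_apply_of_zero d h0 j le_rfl]
    simp [this]
  · push Not at h0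
    obtain ⟨l, hl, hy⟩ := h0
    obtain ⟨t, ht⟩ := exists_addChar_mul_ne_one hθ (mul_ne_zero hr hy)
    obtain ⟨k, hk⟩ := exists_mat_eq_one_add_single (Fin.rev_lt_rev.mpr hl) t
    have hshift : ∀ h : UT n F, θ (r * (y * dagger (mat (h * k))) i j) =
        θ (r * y i l * t) * θ (r * (y * dagger (mat h)) i j) := fun h => by
      have hjj : dagger (mat h) j j = 1 := by rw [dagger_apply, mat_diag]
      rw [mat_mul, dagger_mul, hk, dagger_add, dagger_one, dagger_single, Fin.rev_rev, Fin.rev_rev,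
        add_mul, one_mul, mul_add, Matrix.add_apply, ← mul_assoc, Matrix.mul_apply (M := y * _),
        Finset.sum_eq_single j, mul_single_apply_ite, if_pos rfl, hjj, mul_one, mul_add,
        AddChar.map_add_eq_mul, mul_comm, mul_assoc]
      · intro m _ hm
        rw [mul_single_apply_ite, if_neg hm, zero_mul]
      · simp
    have h1 : 𝔼 h : UT n F, θ (r * (y * dagger (mat h)) i j) =
        θ (r * y i l * t) * 𝔼 h : UT n F, θ (r * (y * dagger (mat h)) i j) := by
      rw [Finset.mul_expect, ← Fintype.expect_equiv (Equiv.mulRight k)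
        (fun h => θ (r * (y * dagger (mat (h * k))) i j)) _ fun h => rfl]
      exact Finset.expect_congr rfl fun h _ => hshift h
    by_contra hne
    exact ht (mul_right_cancel₀ hne ((one_mul _).trans h1)).symm

/-- The entry involves only rows i and rev j of g. These are distinct, hence independent, and row
rev j can be averaged out first. -/
theorem expect_congr_entry [Fintype (UT n F)] {θ : AddChar F ℂ} (hθ : θ ≠ 1) {r : F} (hr : r ≠ 0)
    {i j : Fin n} (hij : i ≠ Fin.rev j) (x : Matrix (Fin n) (Fin n) F) :
    𝔼 g : UT n F, θ (r * (mat g * x * dagger (mat g)) i j) =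
      𝔼 g : UT n F, rowChar θ r i j (mat g * x) := by
  have key := expect_diag {i} (fun g h : UT n F => θ (r * (mat g * x * dagger (mat h)) i j))
    (fun g g' h hg => by
      have hi := hg i (Finset.mem_singleton_self i)
      simp only [Matrix.mul_apply, hi])
    (fun g h h' hh => by
      have hj := hh (Fin.rev j) (by rwa [Finset.mem_singleton, eq_comm])
      simp only [Matrix.mul_apply, dagger_apply, hj])
  simp only [expect_dagger_mul hθ hr] at key
  exact key

/-! ### Elementary characters as averages -/

/-- Put the prescribed entries in row i and their negatives in the mirror column rev i to get a skew
x with x³ = 0. The truncated exponential 1 + x + x²/2 is then orthogonal, and x² lives only at (i,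
rev i), beyond column j. -/
theorem exists_UO_row (hF : ringChar F ≠ 2) {i j : Fin n} (hij : i < j) (hij' : i < Fin.rev j)
    (a : Fin n → F) : ∃ y : UO n F, ∀ k, i < k → k < j → mat (y : UT n F) i k = a k := by
  have hji : j < Fin.rev i := Fin.lt_rev_iff.mp hij'
  have hne : i ≠ Fin.rev i := (hij.trans hji).ne
  let b : Fin n → F := fun k => if i < k ∧ k < j then a k else 0
  have hbi : b i = 0 := if_neg fun h => lt_irrefl _ h.1
  have hbi' : b (Fin.rev i) = 0 := if_neg fun h => h.2.asymm hji
  let x : Matrix (Fin n) (Fin n) F :=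
    Matrix.of fun s t => if s = i then b t else if t = Fin.rev i then -b (Fin.rev s) else 0
  have hx : ∀ s t, x s t = if s = i then b t else if t = Fin.rev i then -b (Fin.rev s) else 0 :=
    fun s t => rfl
  have hxs : ∀ s, x s i = 0 := fun s => by
    rw [hx]
    split_ifs <;> simp_all
  have hxut : x ∈ ut n F := fun s t hst => by
    rw [hx]
    split_ifs with h1 h2
    · subst h1
      exact if_neg fun h => h.1.not_ge hst
    · subst h2
      rw [neg_eq_zero]
      refine if_neg fun h => h.1.not_ge ?_
      rw [← Fin.rev_rev i, Fin.rev_le_rev]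
      exact hst
    · rfl
  have hxsk : dagger x = -x := by
    ext s t
    rw [dagger_apply, Matrix.neg_apply, hx, hx]
    have e1 : Fin.rev t = i ↔ t = Fin.rev i := Fin.rev_eq_iff
    have e2 : Fin.rev s = Fin.rev i ↔ s = i := Fin.rev_inj
    rw [Fin.rev_rev]
    by_cases h1 : s = i <;> by_cases h2 : t = Fin.rev i
    · rw [if_pos (e1.mpr h2), if_pos h1, h1, h2, hbi', neg_zero]
    · rw [if_neg (mt e1.mp h2), if_pos (e2.mpr h1), if_pos h1]
    · rw [if_pos (e1.mpr h2), if_neg h1, if_pos h2, neg_neg]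
    · rw [if_neg (mt e1.mp h2), if_neg (mt e2.mp h1), if_neg h1, if_neg h2, neg_zero]
  have hx2 : ∀ s t, t ≠ Fin.rev i → (x * x) s t = 0 := fun s t ht => by
    rw [Matrix.mul_apply]
    refine Finset.sum_eq_zero fun m _ => ?_
    by_cases hm : m = i
    · rw [hm, hxs, zero_mul]
    · rw [hx m t, if_neg hm, if_neg ht, mul_zero]
  have hx2' : ∀ s t, s ≠ i → (x * x) s t = 0 := fun s t hs => by
    rw [Matrix.mul_apply]
    refine Finset.sum_eq_zero fun m _ => ?_
    rw [hx s m, if_neg hs]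
    split_ifs with hm
    · subst hm
      rw [hx, if_neg hne.symm]
      split_ifs <;> simp [hbi]
    · rw [zero_mul]
  have hx3 : x * x * x = 0 := by
    ext s t
    rw [mul_assoc, Matrix.mul_apply, Matrix.zero_apply]
    refine Finset.sum_eq_zero fun m _ => ?_
    by_cases hm : m = i
    · rw [hm, hxs, zero_mul]
    · rw [hx2' m t hm, mul_zero]
  have h2 := Ring.two_ne_zero hF
  obtain ⟨y, hy⟩ := exists_mat_eq_one_add (x := x + (2 : F)⁻¹ • (x * x))
    ((ut n F).add_mem hxut ((ut n F).smul_mem _ (ut_mul_mem hxut fun s t h => hxut s t h.le)))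
  have hdy : dagger (mat y) = 1 + (-x + (2 : F)⁻¹ • (x * x)) := by
    rw [hy, dagger_add, dagger_one, dagger_add, dagger_smul, dagger_mul, hxsk, neg_mul_neg]
  have hmul : mat y * dagger (mat y) = 1 := by
    have h4 : x * (x * x) = 0 := by rw [← mul_assoc, hx3]
    have h5 : x * x * (x * x) = 0 := by rw [← mul_assoc, hx3, zero_mul]
    have h6 : (2 : F)⁻¹ • (x * x) + (2 : F)⁻¹ • (x * x) = x * x := by
      rw [← add_smul, ← two_mul, mul_inv_cancel₀ h2, one_smul]
    rw [hdy, hy]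
    have : (1 + (x + (2 : F)⁻¹ • (x * x))) * (1 + (-x + (2 : F)⁻¹ • (x * x))) =
        1 + (((2 : F)⁻¹ • (x * x) + (2 : F)⁻¹ • (x * x)) - x * x) +
          (2 : F)⁻¹ • (x * (x * x)) - (2 : F)⁻¹ • (x * x * x) +
          ((2 : F)⁻¹ * (2 : F)⁻¹) • (x * x * (x * x)) := by
      simp only [mul_add, add_mul, mul_one, one_mul, mul_neg, smul_mul_assoc, mul_smul_comm,
        smul_smul, smul_add]
      abel
    rw [this, h6, h4, hx3, h5]
    simp
  refine ⟨⟨y, ?_⟩, fun k hik hkj => ?_⟩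
  · change mat y⁻¹ = dagger (mat y)
    rw [← mul_one (mat y⁻¹), ← hmul, ← mul_assoc, mat_inv_mul, one_mul]
  · change mat y i k = a k
    rw [hy, Matrix.add_apply, Matrix.add_apply, Matrix.smul_apply, Matrix.one_apply_ne hik.ne,
      hx2 i k (hkj.trans hji).ne, hx, if_pos rfl, smul_zero, add_zero, zero_add]
    exact if_pos ⟨hik, hkj⟩

theorem mat_mul_congr_row {i j : Fin n} {g g' : UT n F} (h : ∀ k < j, mat g i k = mat g' i k)
    (x : UT n F) (k : Fin n) (hk : k < j) : mat (g * x) i k = mat (g' * x) i k := by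
  rw [mat_mul, mat_mul, Matrix.mul_apply, Matrix.mul_apply]
  refine Finset.sum_congr rfl fun m _ => ?_
  rcases le_or_gt m k with hm | hm
  · rw [h m (hm.trans_lt hk)]
  · rw [mat_lower x hm, mul_zero, mul_zero]

theorem exists_UO_row' (hF : ringChar F ≠ 2) {i j : Fin n} (hij : i < j) (hij' : i < Fin.rev j)
    (g : UT n F) : ∃ y : UO n F, ∀ k < j, mat (y : UT n F) i k = mat g i k := by
  obtain ⟨y, hy⟩ := exists_UO_row hF hij hij' (mat g i)
  refine ⟨y, fun k hk => ?_⟩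
  rcases lt_trichotomy k i with h | rfl | h
  · rw [mat_lower _ h, mat_lower _ h]
  · rw [mat_diag, mat_diag]
  · exact hy k h hk

/-- A function of the first entries of the `i`-th row has the same average over `UO_n` and
over `UT_n`. -/
theorem expect_UO_eq [Fintype (UT n F)] [Fintype (UO n F)] (hF : ringChar F ≠ 2) {i j : Fin n}
    (hij : i < j) (hij' : i < Fin.rev j) (Θ : UT n F → ℂ)
    (hΘ : ∀ g g', (∀ k < j, mat g i k = mat g' i k) → Θ g = Θ g') :
    𝔼 x : UO n F, Θ x = 𝔼 g, Θ g := by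
  -- The start of row i of g x depends on g only through the start of its row i, so g can be
  -- replaced by an orthogonal y and absorbed by translation.
  have h1 : ∀ g : UT n F, 𝔼 x : UO n F, Θ (g * x) = 𝔼 x : UO n F, Θ x := fun g => by
    obtain ⟨y, hy⟩ := exists_UO_row' hF hij hij' g
    rw [← Fintype.expect_equiv (Equiv.mulLeft y) (fun x : UO n F => Θ ((y : UT n F) * x))
      (fun x => Θ x) fun x => rfl]
    exact Finset.expect_congr rfl fun x _ =>
      hΘ _ _ (mat_mul_congr_row (fun k hk => (hy k hk).symm) x)
  have h2 : ∀ x : UO n F, 𝔼 g, Θ (g * x) = 𝔼 g, Θ g := fun x =>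
    Fintype.expect_equiv (Equiv.mulRight (x : UT n F)) _ _ fun g => rfl
  calc 𝔼 x : UO n F, Θ x = 𝔼 _g : UT n F, 𝔼 x : UO n F, Θ x := by simp
    _ = 𝔼 g : UT n F, 𝔼 x : UO n F, Θ (g * x) :=
      Finset.expect_congr rfl fun g _ => (h1 g).symm
    _ = 𝔼 x : UO n F, 𝔼 g : UT n F, Θ (g * x) := Finset.expect_comm _ _ _
    _ = 𝔼 _x : UO n F, 𝔼 g, Θ g := Finset.expect_congr rfl fun x _ => h2 x
    _ = 𝔼 g, Θ g := by simp

/-- The right cosets of the root subgroup are separated by the j - i - 1 entries of row i strictly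
between columns i and j, which take all values by `exists_UO_row`. -/
theorem card_UO_eq (hF : ringChar F ≠ 2) {p : Fin n × Fin n} (hp : p.1 < p.2)
    (hp' : p.1 < Fin.rev p.2) :
    Nat.card (UO n F) = Nat.card (rootSubgroup n F p) * Nat.card F ^ ((p.2 : ℕ) - p.1 - 1) := by
  choose y hy using exists_UO_row hF hp hp'
  let ext : (Finset.Ioo p.1 p.2 → F) → Fin n → F := fun c k =>
    if h : k ∈ Finset.Ioo p.1 p.2 then c ⟨k, h⟩ else 0
  let Y : (Finset.Ioo p.1 p.2 → F) → UO n F := fun c => y (ext c)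
  let c : UO n F → (Finset.Ioo p.1 p.2 → F) := fun x k => mat (x : UT n F) p.1 k
  have hrow : ∀ x x' : UO n F, c x = c x' →
      ∀ k < p.2, mat (x : UT n F) p.1 k = mat (x' : UT n F) p.1 k := by
    intro x x' h k hk
    rcases lt_trichotomy k p.1 with h' | h' | h'
    · rw [mat_lower _ h', mat_lower _ h']
    · rw [h', mat_diag, mat_diag]
    · exact congrFun h ⟨k, Finset.mem_Ioo.mpr ⟨h', hk⟩⟩
  have hcY : ∀ a, c (Y a) = a := fun a => funext fun k => by
    have hk := Finset.mem_Ioo.mp k.2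
    change mat (y (ext a) : UT n F) p.1 k = a k
    rw [hy _ _ hk.1 hk.2]
    exact dif_pos k.2
  have hmul : ∀ x x' z : UO n F, c x = c x' → c (x * z) = c (x' * z) := fun x x' z h =>
    funext fun k => mat_mul_congr_row (hrow x x' h) z k (Finset.mem_Ioo.mp k.2).2
  have hK : ∀ x : UO n F, x ∈ rootSubgroup n F p ↔ c x = c 1 := fun x => by
    have h1 : ∀ k : Finset.Ioo p.1 p.2, c 1 k = 0 := fun k =>
      Matrix.one_apply_ne (Finset.mem_Ioo.mp k.2).1.ne
    constructor
    · intro hx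
      funext k
      rw [h1]
      exact hx k (Finset.mem_Ioo.mp k.2).1 (Finset.mem_Ioo.mp k.2).2
    · intro hx k hk hk'
      exact (congrFun hx ⟨k, Finset.mem_Ioo.mpr ⟨hk, hk'⟩⟩).trans (h1 _)
  let e : UO n F ≃ rootSubgroup n F p × (Finset.Ioo p.1 p.2 → F) :=
    { toFun := fun x => (⟨x * (Y (c x))⁻¹, (hK _).mpr (by
        rw [hmul x (Y (c x)) _ (hcY _).symm, mul_inv_cancel])⟩, c x)
      invFun := fun q => q.1 * Y q.2
      left_inv := fun x => by simp
      right_inv := fun q => by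
        have h : c ((q.1 : UO n F) * Y q.2) = q.2 := by
          rw [hmul _ 1 _ ((hK _).mp q.1.2), one_mul, hcY]
        refine Prod.ext (Subtype.ext ?_) h
        simp only [h, mul_inv_cancel_right] }
  rw [Nat.card_congr e, Nat.card_prod, Nat.card_fun, Nat.card_eq_fintype_card (α := Finset.Ioo _ _),
    Fintype.card_coe, Fin.card_Ioo]

/-- A conjugate x u x⁻¹ lies in the root subgroup exactly when row i of x(u - 1) vanishes before
column j, so the induction formula averages `rowChar` over UO_n. `expect_UO_eq` passes to UT_n and
`expect_congr_entry` undoes the Fourier inversion; the power of q is the index of the subgroup. -/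
theorem elementaryCharacter_eq_expect [Finite F] [Fintype (UT n F)] (hF : ringChar F ≠ 2)
    (f : SpringerMorphism n F) {θ : AddChar F ℂ} (hθ : θ ≠ 1) {p : Fin n × Fin n} (hp : p.1 < p.2)
    (hp' : p.1 < Fin.rev p.2) {r : F} (hr : r ≠ 0) (u : UO n F) :
    elementaryCharacter θ p r u = (Nat.card F : ℂ) ^ ((p.2 : ℕ) - p.1 - 1) *
      𝔼 g : UT n F, θ (r * (act g (f.onUO u) : Matrix (Fin n) (Fin n) F) p.1 p.2) := by
  have := Fintype.ofFinite (UO n F)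
  obtain ⟨w, hw⟩ := exists_springer_eq_mul f u
  have hx : ∀ x : UO n F, (rootSubgroup n F p : Set (UO n F)).indicator
      (fun u => θ (r * mat (u : UT n F) p.1 p.2)) (x * u * x⁻¹) =
        rowChar θ r p.1 p.2 (mat (x : UT n F) * (mat (u : UT n F) - 1)) := by
    intro x
    have h1 : mat (x : UT n F) * (mat (u : UT n F) - 1) * mat (x : UT n F)⁻¹ =
        mat ((x * u * x⁻¹ : UO n F) : UT n F) - 1 := by
      rw [mul_sub, sub_mul, mul_one, mat_mul_inv]
      rfl
    rw [← rowChar_mul_mat θ r p.1 p.2 _ (x : UT n F)⁻¹, h1, rowChar]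
    have h2 : (∀ l < p.2, (mat ((x * u * x⁻¹ : UO n F) : UT n F) - 1) p.1 l = 0) ↔
        x * u * x⁻¹ ∈ (rootSubgroup n F p : Set (UO n F)) := by
      constructor
      · intro h k hk hk'
        have := h k hk'
        rwa [Matrix.sub_apply, Matrix.one_apply_ne hk.ne, sub_zero] at this
      · intro h l hl
        rcases le_or_gt l p.1 with hl' | hl'
        · exact mat_sub_one_apply _ hl'
        · rw [Matrix.sub_apply, Matrix.one_apply_ne hl'.ne, sub_zero]
          exact h l hl' hl
    by_cases hmem : x * u * x⁻¹ ∈ (rootSubgroup n F p : Set (UO n F))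
    · rw [Set.indicator_of_mem hmem, if_pos (h2.mpr hmem), Matrix.sub_apply,
        Matrix.one_apply_ne hp.ne, sub_zero]
    · rw [Set.indicator_of_notMem hmem, if_neg fun h => hmem (h2.mp h)]
  have hdep : ∀ g g' : UT n F, (∀ k < p.2, mat g p.1 k = mat g' p.1 k) →
      rowChar θ r p.1 p.2 (mat g * (mat (u : UT n F) - 1)) =
        rowChar θ r p.1 p.2 (mat g' * (mat (u : UT n F) - 1)) := fun g g' h =>
    rowChar_congr θ r fun l hl => by
      rw [Matrix.mul_apply, Matrix.mul_apply]
      refine Finset.sum_congr rfl fun m _ => ?_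
      rcases lt_or_ge m l with hm | hm
      · rw [h m (hm.trans_le hl)]
      · rw [mat_sub_one_apply _ hm, mul_zero, mul_zero]
  have hK : (Nat.card (rootSubgroup n F p) : ℂ) ≠ 0 :=
    Nat.cast_ne_zero.mpr Nat.card_pos.ne'
  have hcard : (Fintype.card (UO n F) : ℂ) =
      Nat.card (rootSubgroup n F p) * (Nat.card F : ℂ) ^ ((p.2 : ℕ) - p.1 - 1) := by
    rw [← Nat.card_eq_fintype_card, card_UO_eq hF hp hp']
    push_cast
    rfl
  have hsum : ∑ x : UO n F, rowChar θ r p.1 p.2 (mat (x : UT n F) * (mat (u : UT n F) - 1)) =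
      Fintype.card (UO n F) *
        𝔼 x : UO n F, rowChar θ r p.1 p.2 (mat (x : UT n F) * (mat (u : UT n F) - 1)) := by
    rw [Fintype.expect_eq_sum_div_card, mul_div_cancel₀]
    simp
  rw [elementaryCharacter, induced, finsum_eq_sum_of_fintype, ← Equiv.sum_comp (Equiv.inv _)]
  simp only [Equiv.inv_apply, inv_inv, hx]
  rw [hsum, expect_UO_eq hF hp hp' (fun g => rowChar θ r p.1 p.2 (mat g * (mat (u : UT n F) - 1)))
    hdep, hcard, mul_assoc, inv_mul_cancel_left₀ hK]
  congr 1
  simp only [act_coe]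
  rw [expect_congr_entry hθ hr hp'.ne, onUO_coe, hw]
  exact Finset.expect_congr rfl fun g _ => by rw [← mul_assoc, rowChar_mul_mat]

/-- On the root subgroup the (i, j) entry is additive: the intermediate terms of the product vanish.
-/
theorem isCharacter_elementaryCharacter [Finite F] (θ : AddChar F ℂ) (p : Fin n × Fin n)
    (hp : p.1 < p.2) (r : F) : IsCharacter (elementaryCharacter (n := n) θ p r) := by
  refine isCharacter_induced _ _ ?_ fun a ha b hb => ?_
  · change θ (r * (1 : Matrix (Fin n) (Fin n) F) p.1 p.2) = 1
    rw [Matrix.one_apply_ne hp.ne, mul_zero, AddChar.map_zero_eq_one]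
  · rw [← AddChar.map_add_eq_mul, ← mul_add]
    congr 2
    rw [Subgroup.coe_mul, mat_mul, Matrix.mul_apply,
      Finset.sum_eq_add p.1 p.2 hp.ne, mat_diag, mat_diag, one_mul, mul_one, add_comm]
    · intro m _ hm
      rcases lt_or_gt_of_ne hm.1 with h | h
      · rw [mat_lower _ h, zero_mul]
      · rcases lt_or_gt_of_ne hm.2 with h' | h'
        · rw [ha m h h', zero_mul]
        · rw [mat_lower _ h', mul_zero]
    · simp
    · simp

theorem addChar_map_sum (θ : AddChar F ℂ) {ι : Type*} (D : Finset ι) (a : ι → F) :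
    θ (∑ p ∈ D, a p) = ∏ p ∈ D, θ (a p) := by
  classical
  induction D using Finset.induction_on with
  | empty => simp
  | insert b D hb ih => rw [Finset.sum_insert hb, Finset.prod_insert hb, AddChar.map_add_eq_mul, ih]

/-- The total degree of the elementary characters at the roots in `D` is `q` to this power. -/
def rootDegree (D : Finset (Fin n × Fin n)) : ℕ := ∑ p ∈ D, ((p.2 : ℕ) - p.1 - 1)

/-- Rows i and rev j are the rows of the root (i, j) and of its mirror. Basicness keeps them
disjoint for different roots, so the product of averages is the average of the product. -/
theorem anSupercharacter_eq_expect [Finite F] [Fintype (UT n F)] (hF : ringChar F ≠ 2)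
    (f : SpringerMorphism n F) {θ : AddChar F ℂ} (hθ : θ ≠ 1) {e : Matrix (Fin n) (Fin n) F}
    (he : e ∈ basics n F) (u : UO n F) :
    anSupercharacter θ (rootSet e) (fun p => e p.1 p.2) u =
      (Nat.card F : ℂ) ^ rootDegree (rootSet e) *
        𝔼 g : UT n F, θ (rootFunctional e (act g (f.onUO u))) := by
  have hD := isBasic_rootSet he
  rw [anSupercharacter, rootDegree, ← Finset.prod_pow_eq_pow_sum,
    Finset.prod_congr rfl fun p hp => elementaryCharacter_eq_expect hF f hθ (hD.1 p hp).1
      (hD.1 p hp).2 (mem_rootSet.mp hp).2 u, Finset.prod_mul_distrib]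
  congr 1
  rw [← expect_prod_of_rows (rootSet e) fun p => {p.1, Fin.rev p.2}]
  · refine Finset.expect_congr rfl fun g _ => ?_
    rw [rootFunctional_apply, addChar_map_sum]
  · intro p hp p' hp' hne
    have hm : ∀ q ∈ rootSet e, mirror q ∈ rootSet e ∪ (rootSet e).image mirror := fun q hq =>
      Finset.mem_union_right _ (Finset.mem_image_of_mem _ hq)
    have hl : ∀ q ∈ rootSet e, q ∈ rootSet e ∪ (rootSet e).image mirror := fun q hq =>
      Finset.mem_union_left _ hq
    rw [Finset.disjoint_left]
    intro k hk hk'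
    rw [Finset.mem_insert, Finset.mem_singleton] at hk hk'
    rcases hk with hk | hk <;> rcases hk' with hk' | hk'
    · exact hne (hD.2 p (hl p hp) p' (hl p' hp') (Or.inl (hk.symm.trans hk')))
    · have h := hD.2 p (hl p hp) _ (hm p' hp') (Or.inl (hk.symm.trans hk'))
      exact mirror_notMem hD.1 hp' (h ▸ hp)
    · have h := hD.2 p' (hl p' hp') _ (hm p hp) (Or.inl (hk'.symm.trans hk))
      exact mirror_notMem hD.1 hp (h ▸ hp')
    · have h := hD.2 _ (hm p hp) _ (hm p' hp') (Or.inl (hk.symm.trans hk'))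
      exact hne (by rw [← mirror_mirror p, h, mirror_mirror])
  · intro p hp g h hgh
    have h1 := hgh p.1 (by simp)
    have h2 := hgh (Fin.rev p.2) (by simp)
    simp only [act_coe, Matrix.mul_apply, dagger_apply, h1, h2]

theorem isCharacter_anSupercharacter [Finite F] (θ : AddChar F ℂ) {D : Finset (Fin n × Fin n)}
    (hD : IsBasic D) (φ : Fin n × Fin n → F) : IsCharacter (anSupercharacter (n := n) θ D φ) :=
  isCharacter_prod D fun p hp => isCharacter_elementaryCharacter θ p (hD.1 p hp).1 (φ p)

end Averages

/-! ### Orbits on the dual space and the normalizing constants. -/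

section Orbits

open scoped BigOperators

variable {n : ℕ} {F : Type*} [Field F]

/-! ### Supercharacters as averages -/

theorem mem_dualOrbit_univ {lam μ : Module.Dual F (uo n F)} :
    μ ∈ dualOrbit Set.univ lam ↔ ∃ g : UT n F, μ = lam ∘ₗ act g :=
  ⟨fun ⟨g, _, h⟩ => ⟨g⁻¹, h⟩, fun ⟨g, h⟩ => ⟨g⁻¹, trivial, by rw [inv_inv, h]⟩⟩

theorem comp_act_comp_act (lam : Module.Dual F (uo n F)) (g h : UT n F) :
    (lam ∘ₗ act g) ∘ₗ act h = lam ∘ₗ act (g * h) :=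
  LinearMap.ext fun x => by simp only [LinearMap.comp_apply, act_mul]

theorem comp_act_one (lam : Module.Dual F (uo n F)) : lam ∘ₗ act 1 = lam :=
  LinearMap.ext fun x => by rw [LinearMap.comp_apply, act_one]

theorem comp_act_injective (g : UT n F) :
    Function.Injective fun lam : Module.Dual F (uo n F) => lam ∘ₗ act g := fun lam μ h => by
  have := congrArg (fun ν : Module.Dual F (uo n F) => ν ∘ₗ act g⁻¹) h
  simpa only [comp_act_comp_act, mul_inv_cancel, comp_act_one] using this

instance [Finite F] : Finite (Module.Dual F (uo n F)) := DFunLike.finite _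

/-- The average of `θ ∘ μ` at `x` over the orbit of `lam`, taken over the group. -/
noncomputable def orbitAvg [Fintype (UT n F)] (θ : AddChar F ℂ) (lam : Module.Dual F (uo n F))
    (x : uo n F) : ℂ :=
  𝔼 g : UT n F, θ (lam (act g x))

theorem orbitAvg_act [Fintype (UT n F)] (θ : AddChar F ℂ) (lam : Module.Dual F (uo n F))
    (k : UT n F) (x : uo n F) : orbitAvg θ lam (act k x) = orbitAvg θ lam x :=
  Fintype.expect_equiv (Equiv.mulRight k) _ _ fun g => by rw [Equiv.coe_mulRight, act_mul]

theorem orbitAvg_comp_act [Fintype (UT n F)] (θ : AddChar F ℂ) (lam : Module.Dual F (uo n F))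
    (k : UT n F) (x : uo n F) : orbitAvg θ (lam ∘ₗ act k) x = orbitAvg θ lam x :=
  Fintype.expect_equiv (Equiv.mulLeft k) _ _ fun g => by
    rw [Equiv.coe_mulLeft, act_mul, LinearMap.comp_apply]

theorem orbitAvg_zero [Fintype (UT n F)] (θ : AddChar F ℂ) (lam : Module.Dual F (uo n F)) :
    orbitAvg θ lam 0 = 1 := by
  simp [orbitAvg]

theorem finsum_dualOrbit [Finite F] [Fintype (UT n F)] (θ : AddChar F ℂ)
    (lam : Module.Dual F (uo n F)) (x : uo n F) :
    ∑ᶠ μ ∈ dualOrbit Set.univ lam, θ (μ x) =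
      ((dualOrbit Set.univ lam).ncard : ℂ) * orbitAvg θ lam x := by
  classical
  set O := dualOrbit Set.univ lam
  have hO : O.Finite := Set.toFinite O
  have hshift : ∀ g : UT n F, ∑ μ ∈ hO.toFinset, θ (μ (act g x)) =
      ∑ μ ∈ hO.toFinset, θ (μ x) := by
    intro g
    have hmem : ∀ (k : UT n F), ∀ μ ∈ hO.toFinset, μ ∘ₗ act k ∈ hO.toFinset := by
      intro k μ hμ
      rw [Set.Finite.mem_toFinset, mem_dualOrbit_univ] at hμ ⊢
      obtain ⟨h, rfl⟩ := hμ
      exact ⟨h * k, comp_act_comp_act _ _ _⟩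
    refine Finset.sum_nbij' (fun μ => μ ∘ₗ act g) (fun μ => μ ∘ₗ act g⁻¹) (hmem g) (hmem g⁻¹)
      ?_ ?_ fun μ _ => rfl
    · intro μ _
      rw [comp_act_comp_act, mul_inv_cancel, comp_act_one]
    · intro μ _
      rw [comp_act_comp_act, inv_mul_cancel, comp_act_one]
  rw [finsum_mem_eq_finite_toFinset_sum _ hO]
  calc ∑ μ ∈ hO.toFinset, θ (μ x) = 𝔼 _g : UT n F, ∑ μ ∈ hO.toFinset, θ (μ x) := by simp
    _ = 𝔼 g : UT n F, ∑ μ ∈ hO.toFinset, θ (μ (act g x)) :=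
      Finset.expect_congr rfl fun g _ => (hshift g).symm
    _ = ∑ μ ∈ hO.toFinset, orbitAvg θ μ x := Finset.expect_sum_comm _ _ _
    _ = ∑ μ ∈ hO.toFinset, orbitAvg θ lam x := Finset.sum_congr rfl fun μ hμ => by
      rw [Set.Finite.mem_toFinset, mem_dualOrbit_univ] at hμ
      obtain ⟨h, rfl⟩ := hμ
      exact orbitAvg_comp_act _ _ _ _
    _ = _ := by
      rw [Finset.sum_const, nsmul_eq_mul, Set.ncard_eq_toFinset_card O hO]

theorem supercharacter_eq_orbitAvg [Finite F] [Fintype (UT n F)] (f : SpringerMorphism n F)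
    (θ : AddChar F ℂ) (lam : Module.Dual F (uo n F)) (u : UO n F) :
    supercharacter f θ lam u =
      ((dualOrbit (H n F) lam).ncard : ℂ) * orbitAvg θ lam (f.onUO u) := by
  have hne : ((dualOrbit Set.univ lam).ncard : ℂ) ≠ 0 := by
    rw [Nat.cast_ne_zero, ← Nat.pos_iff_ne_zero, Set.ncard_pos]
    exact ⟨lam, mem_dualOrbit_univ.mpr ⟨1, (comp_act_one lam).symm⟩⟩
  rw [supercharacter, nConst, finsum_dualOrbit, one_div_div, div_mul_eq_mul_div, mul_left_comm,
    mul_div_cancel_left₀ _ hne]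

/-! ### Orbits of `H` on the dual of `uo_n` -/

theorem mem_H_iff {g : UT n F} :
    g ∈ H n F ↔ ∀ i j : Fin n, i ≠ j → j < Fin.rev j → mat g i j = 0 := by
  have : ∀ j : Fin n, j < Fin.rev j ↔ 2 * ((j : ℕ) + 1) ≤ n := fun j => by
    rw [Fin.lt_def, Fin.val_rev]
    omega
  simp only [this]
  rfl

theorem inv_mem_H {g : UT n F} (hg : g ∈ H n F) : g⁻¹ ∈ H n F := by
  rw [mem_H_iff] at hg ⊢
  intro i j hij hj
  have h : (mat g⁻¹ * mat g) i j = 0 := by rw [mat_inv_mul, Matrix.one_apply_ne hij]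
  rwa [Matrix.mul_apply, Finset.sum_eq_single j (fun k _ hk => by rw [hg k j hk hj, mul_zero])
    (by simp), mat_diag, mul_one] at h

/-- Vanishing of the columns in the left half survives multiplication by unitriangular matrices on
either side. Normality makes the size of the H-orbit constant on UT_n-orbits. -/
theorem conj_mem_H {h : UT n F} (hh : h ∈ H n F) (g : UT n F) : g * h * g⁻¹ ∈ H n F := by
  rw [mem_H_iff] at hh ⊢
  have h1 : ∀ i j : Fin n, j < Fin.rev j → (mat h - 1) i j = 0 := fun i j hj => by
    rcases eq_or_ne i j with rfl | hij
    · exact mat_sub_one_apply h le_rfl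
    · rw [Matrix.sub_apply, hh i j hij hj, Matrix.one_apply_ne hij, sub_zero]
  intro i j hij hj
  have h2 : mat (g * h * g⁻¹) = mat g * ((mat h - 1) * mat g⁻¹) + 1 := by
    rw [sub_mul, mul_sub, one_mul, mat_mul_inv, sub_add_cancel, mat_mul, mat_mul, mul_assoc]
  rw [h2, Matrix.add_apply, Matrix.one_apply_ne hij, add_zero, Matrix.mul_apply]
  refine Finset.sum_eq_zero fun k _ => ?_
  rw [Matrix.mul_apply, Finset.sum_eq_zero, mul_zero]
  intro m _
  rcases le_or_gt m j with hm | hm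
  · rw [h1 k m (hm.trans_lt (hj.trans_le (Fin.rev_le_rev.mpr hm))), zero_mul]
  · rw [mat_lower _ hm, mul_zero]

theorem ncard_dualOrbit_H_comp_act (lam : Module.Dual F (uo n F)) (g : UT n F) :
    (dualOrbit (H n F) (lam ∘ₗ act g)).ncard = (dualOrbit (H n F) lam).ncard := by
  have : dualOrbit (H n F) (lam ∘ₗ act g) =
      (fun μ : Module.Dual F (uo n F) => μ ∘ₗ act g) '' dualOrbit (H n F) lam := by
    ext μ
    constructor
    · rintro ⟨h, hh, rfl⟩
      refine ⟨lam ∘ₗ act (g * h * g⁻¹)⁻¹, ⟨_, conj_mem_H hh g, rfl⟩, ?_⟩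
      simp only [comp_act_comp_act]
      congr 2
      group
    · rintro ⟨_, ⟨h, hh, rfl⟩, rfl⟩
      refine ⟨g⁻¹ * h * g, by simpa using conj_mem_H hh g⁻¹, ?_⟩
      simp only [comp_act_comp_act]
      congr 2
      group
  rw [this, Set.ncard_image_of_injective _ (comp_act_injective g)]

/-- All the roots. -/
def allRoots (n : ℕ) : Finset (Fin n × Fin n) :=
  Finset.univ.filter fun p => p.1 < p.2 ∧ p.1 < Fin.rev p.2

theorem mem_allRoots {p : Fin n × Fin n} : p ∈ allRoots n ↔ p.1 < p.2 ∧ p.1 < Fin.rev p.2 := by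
  simp [allRoots]

theorem rootFunctional_congr {y y' : Matrix (Fin n) (Fin n) F}
    (h : ∀ p ∈ allRoots n, y p.1 p.2 = y' p.1 p.2) : rootFunctional y = rootFunctional y' := by
  have key : ∀ (y : Matrix (Fin n) (Fin n) F) (x : uo n F), rootFunctional y x =
      ∑ p ∈ allRoots n, y p.1 p.2 * (x : Matrix (Fin n) (Fin n) F) p.1 p.2 := by
    intro y x
    have hsub : ∀ p : Fin n × Fin n, y p.1 p.2 * (x : Matrix (Fin n) (Fin n) F) p.1 p.2 ≠ 0 →
        p.1 < p.2 ∧ y p.1 p.2 ≠ 0 := fun p hp =>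
      ⟨upper_of_ne_zero x.2 (right_ne_zero_of_mul hp), left_ne_zero_of_mul hp⟩
    rw [rootFunctional_apply]
    refine Finset.sum_congr_of_eq_on_inter ?_ ?_ fun _ _ _ => rfl
    · intro p hp hp'
      by_contra h0
      exact hp' (mem_allRoots.mpr ⟨(hsub p h0).1, (mem_rootSet.mp hp).1⟩)
    · intro p hp hp'
      by_contra h0
      exact hp' (mem_rootSet.mpr ⟨(mem_allRoots.mp hp).2, (hsub p h0).2⟩)
  ext x
  rw [key, key]
  exact Finset.sum_congr rfl fun p hp => by rw [h p hp]

theorem rootFunctional_comp_act (hF : ringChar F ≠ 2) {e : Matrix (Fin n) (Fin n) F}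
    (he : dagger e = -e) (h : UT n F) : rootFunctional e ∘ₗ act h =
      rootFunctional ((mat h).transpose * e * (dagger (mat h)).transpose) := by
  have hsk : dagger ((mat h).transpose * e * (dagger (mat h)).transpose) =
      -((mat h).transpose * e * (dagger (mat h)).transpose) := by
    rw [← dagger_transpose (mat h)]
    exact skew_congr he _
  rw [rootFunctional_eq_traceFunctional hF he, rootFunctional_eq_traceFunctional hF hsk,
    traceFunctional_comp_act]
  congr 1
  rw [mul_smul_comm, smul_mul_assoc, Matrix.transpose_mul, Matrix.transpose_mul,
    Matrix.transpose_transpose, Matrix.transpose_transpose, mul_assoc]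

theorem rootFunctional_injective (hF : ringChar F ≠ 2) {y y' : Matrix (Fin n) (Fin n) F}
    (hy : dagger y = -y) (hy' : dagger y' = -y') (h : rootFunctional y = rootFunctional y')
    {i j : Fin n} (hij : i < j) : y i j = y' i j := by
  have h2 := inv_ne_zero (Ring.two_ne_zero hF)
  have hsk : ∀ {e : Matrix (Fin n) (Fin n) F}, dagger e = -e →
      dagger ((2 : F)⁻¹ • e.transpose) = -((2 : F)⁻¹ • e.transpose) := fun he => by
    rw [dagger_smul, dagger_transpose, he, Matrix.transpose_neg, smul_neg]
  rw [rootFunctional_eq_traceFunctional hF hy, rootFunctional_eq_traceFunctional hF hy'] at h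
  have := lower_eq_of_traceFunctional_eq hF (hsk hy) (hsk hy') h j i hij
  exact mul_left_cancel₀ h2 this

/-- The positions in the left half whose row has a nonzero entry of `e` further to the right. -/
noncomputable def freePositions (e : Matrix (Fin n) (Fin n) F) : Finset (Fin n × Fin n) :=
  (rootSet e ∪ (rootSet e).image mirror).biUnion fun p =>
    ((Finset.Ioo p.1 p.2).filter fun t => t ≤ Fin.rev t).image fun t => (p.1, t)

theorem mem_rootSet_union_mirror (hF : ringChar F ≠ 2) {e : Matrix (Fin n) (Fin n) F}
    (he : dagger e = -e) {p : Fin n × Fin n} :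
    p ∈ rootSet e ∪ (rootSet e).image mirror ↔ e p.1 p.2 ≠ 0 := by
  rw [Finset.mem_union, Finset.mem_image]
  constructor
  · rintro (h | ⟨q, hq, rfl⟩)
    · exact (mem_rootSet.mp h).2
    · change e (Fin.rev q.2) (Fin.rev q.1) ≠ 0
      rw [skew_apply he, neg_ne_zero]
      exact (mem_rootSet.mp hq).2
  · intro h
    rcases lt_trichotomy p.1 (Fin.rev p.2) with h1 | h1 | h1
    · exact Or.inl (mem_rootSet.mpr ⟨h1, h⟩)
    · have := skew_antidiag hF he p.1
      rw [h1, Fin.rev_rev, ← h1] at this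
      exact absurd this h
    · refine Or.inr ⟨mirror p, mem_rootSet.mpr ⟨?_, ?_⟩, mirror_mirror p⟩
      · simpa [mirror] using h1
      · change e (Fin.rev p.2) (Fin.rev p.1) ≠ 0
        rwa [skew_apply he, neg_ne_zero]

theorem mem_freePositions (hF : ringChar F ≠ 2) {e : Matrix (Fin n) (Fin n) F}
    (he : dagger e = -e) {p : Fin n × Fin n} :
    p ∈ freePositions e ↔ p.1 < p.2 ∧ p.2 ≤ Fin.rev p.2 ∧ ∃ l, p.2 < l ∧ e p.1 l ≠ 0 := by
  simp only [freePositions, Finset.mem_biUnion, mem_rootSet_union_mirror hF he, Finset.mem_image,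
    Finset.mem_filter, Finset.mem_Ioo]
  constructor
  · rintro ⟨q, hq, t, ⟨⟨h1, h2⟩, h3⟩, rfl⟩
    exact ⟨h1, h3, q.2, h2, hq⟩
  · rintro ⟨h1, h2, l, h3, h4⟩
    exact ⟨(p.1, l), h4, p.2, ⟨⟨h1, h3⟩, h2⟩, rfl⟩

theorem mem_allRoots_of_mem_freePositions (hF : ringChar F ≠ 2) {e : Matrix (Fin n) (Fin n) F}
    (he : dagger e = -e) {p : Fin n × Fin n} (hp : p ∈ freePositions e) : p ∈ allRoots n := by
  obtain ⟨h1, h2, -⟩ := (mem_freePositions hF he).mp hp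
  exact mem_allRoots.mpr ⟨h1, h1.trans_le h2⟩

/-- The row index s of a root lies in the left half, where columns of `h` are trivial, so the left
factor does not affect row s. The right factor likewise affects column t only if t ≤ rev t. -/
theorem H_congr_apply {e : Matrix (Fin n) (Fin n) F} {h : UT n F} (hh : h ∈ H n F) {s t : Fin n}
    (hst : s < t) (hst' : s < Fin.rev t) :
    ((mat h).transpose * e * (dagger (mat h)).transpose) s t =
      if t ≤ Fin.rev t then ∑ l, e s l * mat h (Fin.rev l) (Fin.rev t) else e s t := by
  rw [mem_H_iff] at hh
  have hs : s < Fin.rev s := by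
    rcases le_or_gt t (Fin.rev t) with h' | h'
    · exact hst.trans_le (h'.trans (Fin.rev_le_rev.mpr hst.le))
    · exact hst'.trans (Fin.rev_lt_rev.mpr hst)
  have h1 : ∀ l, ((mat h).transpose * e) s l = e s l := fun l => by
    rw [Matrix.mul_apply, Finset.sum_eq_single s, Matrix.transpose_apply, mat_diag, one_mul]
    · intro k _ hk
      rw [Matrix.transpose_apply, hh k s hk hs, zero_mul]
    · simp
  rw [Matrix.mul_apply]
  simp only [h1, Matrix.transpose_apply, dagger_apply]
  split_ifs with ht
  · rfl
  · rw [Finset.sum_eq_single t, mat_diag, mul_one]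
    · intro l _ hl
      rw [hh _ _ (fun h' => hl (Fin.rev_inj.mp h')) (by rw [Fin.rev_rev]; exact not_le.mp ht),
        mul_zero]
    · simp

theorem H_congr_apply_of_notMem (hF : ringChar F ≠ 2) {e : Matrix (Fin n) (Fin n) F}
    (he : dagger e = -e) {h : UT n F} (hh : h ∈ H n F) {p : Fin n × Fin n}
    (hp : p ∈ allRoots n) (hp' : p ∉ freePositions e) :
    ((mat h).transpose * e * (dagger (mat h)).transpose) p.1 p.2 = e p.1 p.2 := by
  have hpr := mem_allRoots.mp hp
  rw [H_congr_apply hh hpr.1 hpr.2]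
  split_ifs with ht
  · rw [Finset.sum_eq_single p.2, mat_diag, mul_one]
    · intro l _ hl
      rcases lt_or_gt_of_ne hl with hl | hl
      · rw [mat_lower _ (Fin.rev_lt_rev.mpr hl), mul_zero]
      · by_cases h0 : e p.1 l = 0
        · rw [h0, zero_mul]
        · exact absurd ((mem_freePositions hF he).mpr ⟨hpr.1, ht, l, hl, h0⟩) hp'
    · simp
  · rfl

theorem exists_mem_H (hF : ringChar F ≠ 2) {e : Matrix (Fin n) (Fin n) F} (he : e ∈ basics n F)
    (c : Fin n × Fin n → F) : ∃ h ∈ H n F, ∀ p ∈ freePositions e,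
      ((mat h).transpose * e * (dagger (mat h)).transpose) p.1 p.2 = c p := by
  -- Row s is filled from its pivot at column l by the coefficient c(s, t) / e s l at (rev l, rev
  -- t). The sum over s merely selects the row with its pivot in column rev a, since 0⁻¹ = 0 and
  -- columns have at most one nonzero entry.
  let m : Matrix (Fin n) (Fin n) F := Matrix.of fun a b =>
    if a = b then 1 else if a < b ∧ Fin.rev b ≤ b then
      ∑ s, c (s, Fin.rev b) * (e s (Fin.rev a))⁻¹ else 0
  have hm : ∀ a b, m a b = if a = b then 1 else if a < b ∧ Fin.rev b ≤ b then
      ∑ s, c (s, Fin.rev b) * (e s (Fin.rev a))⁻¹ else 0 := fun a b => rfl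
  obtain ⟨h, hh⟩ := exists_mat_eq (m := m)
    (fun i j hij => by rw [hm, if_neg hij.ne', if_neg fun h' => hij.asymm h'.1])
    fun i => by rw [hm, if_pos rfl]
  have hH : h ∈ H n F := mem_H_iff.mpr fun i j hij hj => by
    rw [hh, hm, if_neg hij, if_neg fun h' => h'.2.not_gt hj]
  refine ⟨h, hH, fun p hp => ?_⟩
  obtain ⟨h1, h2, l, h3, h4⟩ := (mem_freePositions hF he.1.2).mp hp
  rw [H_congr_apply hH h1 (h1.trans_le h2), if_pos h2, Finset.sum_eq_single l, hh, hm,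
    if_neg fun h' => h3.ne' (Fin.rev_inj.mp h'), if_pos ⟨Fin.rev_lt_rev.mpr h3, by rwa [Fin.rev_rev]⟩,
    Finset.sum_eq_single p.1, Fin.rev_rev, Fin.rev_rev, mul_left_comm, mul_inv_cancel₀ h4, mul_one]
  · intro s _ hs
    by_cases h0 : e s l = 0
    · rw [Fin.rev_rev, Fin.rev_rev, h0, inv_zero, mul_zero]
    · exact absurd (he.2.2 _ _ _ h0 h4) hs
  · simp
  · intro l' _ hl'
    by_cases h0 : e p.1 l' = 0
    · rw [h0, zero_mul]
    · exact absurd (he.2.1 _ _ _ h0 h4) hl'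
  · simp

/-- Under H, the coordinates at free positions take all values independently and the other root
coordinates are fixed. -/
theorem ncard_dualOrbit_H_rootFunctional [Finite F] (hF : ringChar F ≠ 2)
    {e : Matrix (Fin n) (Fin n) F} (he : e ∈ basics n F) :
    (dualOrbit (H n F) (rootFunctional e)).ncard = Nat.card F ^ (freePositions e).card := by
  classical
  let Y : (freePositions e → F) → Matrix (Fin n) (Fin n) F := fun c =>
    basicElement (allRoots n) fun p => if h : p ∈ freePositions e then c ⟨p, h⟩ else e p.1 p.2
  have hY : ∀ c, ∀ p ∈ allRoots n,
      Y c p.1 p.2 = if h : p ∈ freePositions e then c ⟨p, h⟩ else e p.1 p.2 := fun c p hp =>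
    basicElement_apply_of_mem (fun p hp => mem_allRoots.mp hp) _ hp
  have hsub : ∀ p ∈ freePositions e, p ∈ allRoots n := fun p hp =>
    mem_allRoots_of_mem_freePositions hF he.1.2 hp
  have hinj : Function.Injective fun c => rootFunctional (Y c) := fun c c' h => by
    funext p
    have hp := hsub p p.2
    have := rootFunctional_injective hF (dagger_basicElement _ _) (dagger_basicElement _ _) h
      (mem_allRoots.mp hp).1
    change Y c p.1.1 p.1.2 = Y c' p.1.1 p.1.2 at this
    rwa [hY c p hp, hY c' p hp, dif_pos p.2, dif_pos p.2] at this
  have hrange : dualOrbit (H n F) (rootFunctional e) =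
      Set.range fun c => rootFunctional (Y c) := by
    have key : ∀ h ∈ H n F, ∀ c : freePositions e → F,
        (∀ p : freePositions e, ((mat h).transpose * e * (dagger (mat h)).transpose) p.1.1 p.1.2 =
          c p) → rootFunctional e ∘ₗ act h = rootFunctional (Y c) := by
      intro h hh c hc
      rw [rootFunctional_comp_act hF he.1.2]
      refine rootFunctional_congr fun p hp => ?_
      rw [hY c p hp]
      split_ifs with hp'
      · exact hc ⟨p, hp'⟩
      · exact H_congr_apply_of_notMem hF he.1.2 hh hp hp'
    ext μ
    constructor
    · rintro ⟨g, hg, rfl⟩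
      let M := (mat g⁻¹).transpose * e * (dagger (mat g⁻¹)).transpose
      exact ⟨fun p => M p.1.1 p.1.2,
        (key g⁻¹ (inv_mem_H hg) (fun p => M p.1.1 p.1.2) fun p => rfl).symm⟩
    · rintro ⟨c, rfl⟩
      obtain ⟨h, hh, hc⟩ := exists_mem_H hF he
        fun p => if h : p ∈ freePositions e then c ⟨p, h⟩ else 0
      refine ⟨h⁻¹, inv_mem_H hh, ?_⟩
      rw [inv_inv]
      exact (key h hh c fun p => (hc p p.2).trans (dif_pos p.2)).symm
  rw [hrange, ← Set.image_univ, Set.ncard_image_of_injective _ hinj, Set.ncard_univ, Nat.card_fun,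
    Nat.card_eq_fintype_card (α := freePositions e), Fintype.card_coe]

/-- A root (i, j) contributes the t between i and j with t ≤ rev t, and its mirror, after
reflection, those with rev t ≤ t. Together they count j - i - 1 positions, with a middle column
counted twice; one lies strictly between exactly when n is odd and rev j < j. -/
theorem card_freePositions {e : Matrix (Fin n) (Fin n) F} (he : e ∈ basics n F) :
    (freePositions e).card = rootDegree (rootSet e) + normExponent (rootSet e) := by
  have hD := isBasic_rootSet he
  have hdisj : Disjoint (rootSet e) ((rootSet e).image mirror) := by
    rw [Finset.disjoint_left]
    intro p hp hp'
    obtain ⟨q, hq, rfl⟩ := Finset.mem_image.mp hp'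
    exact mirror_notMem hD.1 hq hp
  have hleft : ∀ p : Fin n × Fin n,
      ((Finset.Ioo (mirror p).1 (mirror p).2).filter fun t => t ≤ Fin.rev t).card =
        ((Finset.Ioo p.1 p.2).filter fun t => Fin.rev t ≤ t).card := by
    intro p
    refine Finset.card_nbij' Fin.rev Fin.rev ?_ ?_ (fun t _ => Fin.rev_rev t)
      fun t _ => Fin.rev_rev t
    · intro t ht
      simp only [mirror, Finset.coe_filter, Finset.mem_Ioo, Set.mem_ofPred_eq, Fin.rev_rev] at ht ⊢
      exact ⟨⟨Fin.lt_rev_iff.mp ht.1.2, Fin.rev_lt_iff.mp ht.1.1⟩, ht.2⟩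
    · intro t ht
      simp only [mirror, Finset.coe_filter, Finset.mem_Ioo, Set.mem_ofPred_eq, Fin.rev_rev] at ht ⊢
      exact ⟨⟨Fin.rev_lt_rev.mpr ht.1.2, Fin.rev_lt_rev.mpr ht.1.1⟩, ht.2⟩
  have hcount : ∀ p ∈ rootSet e,
      ((Finset.Ioo p.1 p.2).filter fun t => t ≤ Fin.rev t).card +
        ((Finset.Ioo p.1 p.2).filter fun t => Fin.rev t ≤ t).card =
      ((p.2 : ℕ) - p.1 - 1) + if ¬ Even n ∧ Fin.rev p.2 < p.2 then 1 else 0 := by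
    intro p hp
    obtain ⟨h1, h2⟩ := hD.1 p hp
    rw [← Finset.card_union_add_card_inter, ← Finset.filter_or, ← Finset.filter_and,
      Finset.filter_true_of_mem (fun t _ => le_total t (Fin.rev t)), Fin.card_Ioo]
    congr 1
    rw [Fin.lt_def, Fin.val_rev] at h2
    split_ifs with hc
    · obtain ⟨hodd, hc⟩ := hc
      obtain ⟨m, hm⟩ := Nat.not_even_iff_odd.mp hodd
      rw [Fin.lt_def, Fin.val_rev] at hc
      rw [Finset.card_eq_one]
      refine ⟨⟨m, by omega⟩, ?_⟩
      ext t
      simp only [Finset.mem_filter, Finset.mem_Ioo, Finset.mem_singleton, Fin.lt_def, Fin.le_def,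
        Fin.val_rev, Fin.ext_iff]
      omega
    · rw [Finset.card_eq_zero, Finset.filter_eq_empty_iff]
      intro t ht
      rw [Finset.mem_Ioo] at ht
      rw [not_and_or, not_not] at hc
      simp only [Fin.lt_def, Fin.le_def, Fin.val_rev] at ht hc ⊢
      rcases hc with ⟨m, hm⟩ | hc <;> omega
  rw [freePositions, Finset.card_biUnion]
  · have himg : ∀ p : Fin n × Fin n,
        (((Finset.Ioo p.1 p.2).filter fun t => t ≤ Fin.rev t).image fun t => (p.1, t)).card =
          ((Finset.Ioo p.1 p.2).filter fun t => t ≤ Fin.rev t).card := fun p =>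
      Finset.card_image_of_injective _ fun _ _ h => congrArg Prod.snd h
    simp only [himg]
    rw [Finset.sum_union hdisj, Finset.sum_image fun p _ q _ h => by
      rw [← mirror_mirror p, h, mirror_mirror]]
    simp only [hleft]
    rw [← Finset.sum_add_distrib, Finset.sum_congr rfl hcount, Finset.sum_add_distrib, rootDegree,
      normExponent]
    congr 1
    by_cases hn : Even n <;> simp [hn]
  · intro p hp q hq hne
    rw [Function.onFun, Finset.disjoint_left]
    intro r hr hr'
    obtain ⟨t, -, rfl⟩ := Finset.mem_image.mp hr
    obtain ⟨t', -, h⟩ := Finset.mem_image.mp hr'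
    exact hne (hD.2 p hp q hq (Or.inl (congrArg Prod.fst h).symm))

end Orbits

/-! ### The supercharacter axioms and the comparison. -/

section Theories

open scoped BigOperators

variable {n : ℕ} {F : Type*} [Field F]

/-! ### Orthogonality -/

theorem sum_addChar_functional [Fintype (uo n F)] {θ : AddChar F ℂ} (hθ : θ ≠ 1)
    {ν : Module.Dual F (uo n F)} (hν : ν ≠ 0) : ∑ x, θ (ν x) = 0 := by
  refine (AddChar.sum_eq_zero_iff_ne_zero
    (ψ := θ.compAddMonoidHom ν.toAddMonoidHom)).mpr fun h => ?_
  obtain ⟨x, hx⟩ := DFunLike.ne_iff.mp hν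
  obtain ⟨t, ht⟩ := exists_addChar_mul_ne_one hθ hx
  refine ht ?_
  have := DFunLike.congr_fun h (t • x)
  rw [mul_comm, ← smul_eq_mul, ← map_smul]
  exact this

theorem sum_addChar_dual [Fintype (Module.Dual F (uo n F))] {θ : AddChar F ℂ} (hθ : θ ≠ 1)
    {x : uo n F} (hx : x ≠ 0) : ∑ lam : Module.Dual F (uo n F), θ (lam x) = 0 := by
  refine (AddChar.sum_eq_zero_iff_ne_zero (ψ := θ.compAddMonoidHom
    (Module.Dual.eval F (uo n F) x).toAddMonoidHom)).mpr fun h => ?_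
  obtain ⟨lam, hlam⟩ := not_forall.mp (mt (Module.forall_dual_apply_eq_zero_iff F x).mp hx)
  obtain ⟨t, ht⟩ := exists_addChar_mul_ne_one hθ hlam
  refine ht ?_
  have := DFunLike.congr_fun h (t • lam)
  rw [mul_comm]
  exact this

theorem star_orbitAvg [Finite F] [Fintype (UT n F)] (θ : AddChar F ℂ)
    (lam : Module.Dual F (uo n F)) (x : uo n F) :
    star (orbitAvg θ lam x) = 𝔼 g : UT n F, θ (-lam (act g x)) := by
  rw [orbitAvg, Fintype.expect_eq_sum_div_card, Fintype.expect_eq_sum_div_card, star_div₀,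
    star_sum, star_natCast]
  congr 1
  refine Finset.sum_congr rfl fun g _ => ?_
  rw [AddChar.map_neg_eq_conj]
  rfl

/-- The product averages θ over differences of functionals from two different orbits; each
difference is nonzero, so its character sum vanishes. -/
theorem sum_orbitAvg_mul_star [Finite F] [Fintype (UT n F)] [Fintype (uo n F)]
    {θ : AddChar F ℂ} (hθ : θ ≠ 1) {lam μ : Module.Dual F (uo n F)}
    (h : ∀ g : UT n F, μ ≠ lam ∘ₗ act g) :
    ∑ x, orbitAvg θ lam x * star (orbitAvg θ μ x) = 0 := by
  have h1 : ∀ x, orbitAvg θ lam x * star (orbitAvg θ μ x) =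
      𝔼 g : UT n F, 𝔼 k : UT n F, θ ((lam ∘ₗ act g - μ ∘ₗ act k) x) := fun x => by
    rw [star_orbitAvg, orbitAvg, Finset.expect_mul]
    refine Finset.expect_congr rfl fun g _ => ?_
    rw [Finset.mul_expect]
    refine Finset.expect_congr rfl fun k _ => ?_
    rw [← AddChar.map_add_eq_mul, ← sub_eq_add_neg]
    rfl
  simp only [h1]
  rw [← Finset.expect_sum_comm]
  refine Finset.expect_eq_zero fun g _ => ?_
  rw [← Finset.expect_sum_comm]
  refine Finset.expect_eq_zero fun k _ => sum_addChar_functional hθ fun h0 => ?_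
  refine h (g * k⁻¹) ?_
  rw [← comp_act_comp_act, sub_eq_zero.mp h0, comp_act_comp_act, mul_inv_cancel, comp_act_one]

theorem onUO_one (f : SpringerMorphism n F) : f.onUO 1 = 0 := by
  obtain ⟨w, hw⟩ := exists_springer_eq_mul f 1
  refine Subtype.ext ?_
  rw [onUO_coe, Subgroup.coe_one, hw, mat_one, sub_self, zero_mul]
  rfl

theorem charInner_self_ne_zero {G : Type*} [Group G] [Finite G] {χ : G → ℂ} (h : χ 1 ≠ 0) :
    charInner χ χ ≠ 0 := by
  have := Fintype.ofFinite G
  rw [charInner, finsum_eq_sum_of_fintype]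
  refine mul_ne_zero (by simp) ?_
  have h1 : ∀ g, χ g * star (χ g) = (Complex.normSq (χ g) : ℂ) := fun g => Complex.mul_conj _
  simp only [h1]
  rw [← Complex.ofReal_sum, Complex.ofReal_ne_zero]
  exact (Finset.sum_pos' (fun g _ => Complex.normSq_nonneg _)
    ⟨1, Finset.mem_univ _, Complex.normSq_pos.mpr h⟩).ne'

/-- Characters proportional to the orbit averages of the functionals attached to monomial
elements are the supercharacters of a supercharacter theory. -/
theorem isSupercharacterTheory_of_orbitAvg [Finite F] [Fintype (UT n F)] (hF : ringChar F ≠ 2)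
    (f : SpringerMorphism n F) {θ : AddChar F ℂ} (hθ : θ ≠ 1)
    (η : Matrix (Fin n) (Fin n) F → UO n F → ℂ) (c : Matrix (Fin n) (Fin n) F → ℂ)
    (hη : ∀ e ∈ basics n F, ∀ u, η e u = c e * orbitAvg θ (rootFunctional e) (f.onUO u))
    (hchar : ∀ e ∈ basics n F, IsCharacter (η e)) (hc : ∀ e ∈ basics n F, c e ≠ 0) :
    IsSupercharacterTheory (superclasses f) (η '' basics n F) := by
  have := Fintype.ofFinite (UO n F)
  have := Fintype.ofFinite (uo n F)
  have := Fintype.ofFinite (Module.Dual F (uo n F))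
  have hsum : ∀ Φ : uo n F → ℂ, ∑ u : UO n F, Φ (f.onUO u) = ∑ x, Φ x := fun Φ =>
    Equiv.sum_comp (Equiv.ofBijective _ (onUO_bijective f)) Φ
  have horth : ∀ e ∈ basics n F, ∀ e' ∈ basics n F, e ≠ e' → charInner (η e) (η e') = 0 := by
    intro e he e' he' hne
    rw [charInner, finsum_eq_sum_of_fintype]
    have h1 : ∀ u, η e u * star (η e' u) = c e * star (c e') *
        (orbitAvg θ (rootFunctional e) (f.onUO u) *
          star (orbitAvg θ (rootFunctional e') (f.onUO u))) := fun u => by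
      rw [hη e he, hη e' he', star_mul']
      ring
    simp only [h1]
    rw [← Finset.mul_sum, hsum fun x => orbitAvg θ (rootFunctional e) x *
      star (orbitAvg θ (rootFunctional e') x), sum_orbitAvg_mul_star hθ, mul_zero, mul_zero]
    exact fun g hg => hne (rootFunctional_orbit_injective hF he he' hg)
  have hone : ∀ e ∈ basics n F, η e 1 ≠ 0 := fun e he => by
    rw [hη e he, onUO_one, orbitAvg_zero, mul_one]
    exact hc e he
  have hinj : Set.InjOn η (basics n F) := fun e he e' he' h => by
    by_contra hne
    have h0 := horth e he e' he' hne
    rw [← h] at h0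
    exact charInner_self_ne_zero (hone e he) h0
  refine isSupercharacterTheory_of_orthogonal (isPartition_superclasses f) ?_ ?_ ?_ ?_ ?_ ?_
  · rintro _ ⟨u, rfl⟩ v ⟨g, hg⟩ k
    exact ⟨k * g, by rw [onUO_conj, hg, act_mul]⟩
  · rintro _ ⟨e, he, rfl⟩
    exact hchar e he
  · rw [superclasses_eq_image hF f, hinj.ncard_image,
      (congrClass_injOn f).ncard_image]
  · rintro _ ⟨e, he, rfl⟩ _ ⟨u, rfl⟩ v ⟨g, hg⟩ w ⟨k, hk⟩
    rw [hη e he, hη e he, hg, hk, orbitAvg_act, orbitAvg_act]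
  · rintro _ ⟨e, he, rfl⟩ _ ⟨e', he', rfl⟩ hne
    exact horth e he e' he' fun h => hne (by rw [h])
  · intro ψ hψ
    by_contra hno
    push Not at hno
    have h0 : ∀ lam : Module.Dual F (uo n F),
        ∑ u : UO n F, orbitAvg θ lam (f.onUO u) * star (ψ u) = 0 := by
      intro lam
      obtain ⟨e, g, he, rfl⟩ := exists_rootFunctional_comp_act hF lam
      have h1 := hno _ ⟨e, he, rfl⟩
      rw [charInner, finsum_eq_sum_of_fintype] at h1
      have h2 := (mul_eq_zero.mp h1).resolve_left (by simp)
      simp only [hη e he, mul_assoc] at h2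
      rw [← Finset.mul_sum] at h2
      simp only [orbitAvg_comp_act]
      exact (mul_eq_zero.mp h2).resolve_left (hc e he)
    -- The averages summed over all functionals vanish away from 1, so an irreducible ψ orthogonal
    -- to every one of them would satisfy ψ(1) = 0.
    have hdelta : ∀ u : UO n F, u ≠ 1 →
        ∑ lam : Module.Dual F (uo n F), orbitAvg θ lam (f.onUO u) = 0 := by
      intro u hu
      simp only [orbitAvg]
      rw [← Finset.expect_sum_comm]
      refine Finset.expect_eq_zero fun g _ => sum_addChar_dual hθ fun h => hu ?_
      have h2 : f.onUO u = 0 := by rw [← act_inv_act g (f.onUO u), h, map_zero]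
      exact (onUO_bijective f).1 (h2.trans (onUO_one f).symm)
    have h3 : ∑ u : UO n F, (∑ lam : Module.Dual F (uo n F), orbitAvg θ lam (f.onUO u)) *
        star (ψ u) = 0 := by
      simp only [Finset.sum_mul]
      rw [Finset.sum_comm]
      exact Finset.sum_eq_zero fun lam _ => h0 lam
    rw [Finset.sum_eq_single 1 (fun u _ hu => by rw [hdelta u hu, zero_mul]) (by simp)] at h3
    simp only [onUO_one, orbitAvg_zero] at h3
    refine hψ.apply_one_ne_zero (star_eq_zero.mp ((mul_eq_zero.mp h3).resolve_left ?_))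
    simp

/-! ### Comparison of the two families of supercharacters -/

/-- Multiplicative shifts of θ are distinct and as numerous as all additive characters. Rescaling
`e` by c thus reconciles the independent choices of θ and θ'. -/
theorem exists_addChar_eq_mulShift [Finite F] {θ θ' : AddChar F ℂ} (hθ : θ ≠ 1) (hθ' : θ' ≠ 1) :
    ∃ c : F, c ≠ 0 ∧ ∀ x, θ' x = θ (c * x) := by
  have := Fintype.ofFinite F
  have hinj := AddChar.to_mulShift_inj_of_isPrimitive (AddChar.IsPrimitive.of_ne_one hθ)
  have hbij := (Fintype.bijective_iff_injective_and_card _).mpr ⟨hinj, AddChar.card_eq.symm⟩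
  obtain ⟨c, hc⟩ := hbij.2 θ'
  have hx : ∀ x, θ' x = θ (c * x) := fun x => by rw [← hc, AddChar.mulShift_apply]
  refine ⟨c, ?_, hx⟩
  rintro rfl
  refine hθ' (DFunLike.ext _ _ fun x => ?_)
  rw [hx, zero_mul, AddChar.map_zero_eq_one, AddChar.one_apply]

theorem rootSet_smul {c : F} (hc : c ≠ 0) (e : Matrix (Fin n) (Fin n) F) :
    rootSet (c • e) = rootSet e := by
  ext p
  simp [mem_rootSet, hc]

theorem supercharacter_rootFunctional [Finite F] (hF : ringChar F ≠ 2) (f : SpringerMorphism n F)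
    {θ θ' : AddChar F ℂ} (hθ' : θ' ≠ 1) {c : F} (hc : c ≠ 0) (hcθ : ∀ x, θ' x = θ (c * x))
    {e : Matrix (Fin n) (Fin n) F} (he : e ∈ basics n F) :
    supercharacter f θ (rootFunctional (c • e)) =
      ((Nat.card F : ℂ) ^ normExponent (rootSet e)) •
        anSupercharacter θ' (rootSet e) fun p => e p.1 p.2 := by
  have := Fintype.ofFinite (UT n F)
  funext u
  rw [supercharacter_eq_orbitAvg, ncard_dualOrbit_H_rootFunctional hF (smul_mem_basics c he),
    card_freePositions (smul_mem_basics c he), rootSet_smul hc, Pi.smul_apply, smul_eq_mul,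
    anSupercharacter_eq_expect hF f hθ' he, ← mul_assoc, ← pow_add, add_comm, Nat.cast_pow]
  congr 1
  refine Finset.expect_congr rfl fun g _ => ?_
  rw [rootFunctional_smul c hc, hcθ, LinearMap.smul_apply, smul_eq_mul]

theorem supercharacters_eq_image [Finite F] (hF : ringChar F ≠ 2) (f : SpringerMorphism n F)
    {θ θ' : AddChar F ℂ} (hθ : θ ≠ 1) (hθ' : θ' ≠ 1) :
    supercharacters f θ = (fun e => ((Nat.card F : ℂ) ^ normExponent (rootSet e)) •
      anSupercharacter (n := n) θ' (rootSet e) fun p => e p.1 p.2) '' basics n F := by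
  have := Fintype.ofFinite (UT n F)
  obtain ⟨c, hc, hcθ⟩ := exists_addChar_eq_mulShift hθ hθ'
  ext χ
  constructor
  · rintro ⟨lam, rfl⟩
    obtain ⟨e, g, he, rfl⟩ := exists_rootFunctional_comp_act hF lam
    refine ⟨c⁻¹ • e, smul_mem_basics _ he, ?_⟩
    simp only
    rw [← supercharacter_rootFunctional hF f hθ' hc hcθ (smul_mem_basics c⁻¹ he), smul_smul,
      mul_inv_cancel₀ hc, one_smul]
    funext u
    rw [supercharacter_eq_orbitAvg, supercharacter_eq_orbitAvg, ncard_dualOrbit_H_comp_act,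
      orbitAvg_comp_act]
  · rintro ⟨e, he, rfl⟩
    exact ⟨_, supercharacter_rootFunctional hF f hθ' hc hcθ he⟩

end Theories

end UnipOrth

/-! ### Assembly of the theorem. -/

theorem mainTheorem6 {F : Type*} [Field F] [Finite F] (hF : ringChar F ≠ 2) (n : ℕ)
    (f : UnipOrth.SpringerMorphism n F) (θ θ' : AddChar F ℂ) (hθ : θ ≠ 1) (hθ' : θ' ≠ 1) :
    -- both constructions give supercharacter theories
    UnipOrth.IsSupercharacterTheory (UnipOrth.superclasses f) (UnipOrth.supercharacters f θ) ∧
    UnipOrth.IsSupercharacterTheory (UnipOrth.anSuperclasses n F)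
      (UnipOrth.anSupercharacters n θ') ∧
    -- the superclasses are the same
    UnipOrth.superclasses f = UnipOrth.anSuperclasses n F ∧
    UnipOrth.superclasses f =
      {S | S.Nonempty ∧ ∃ g : UnipOrth.UT n F,
        S = {u : UnipOrth.UO n F | (u : UnipOrth.UT n F) ∈ UnipOrth.algSuperclass g}} ∧
    -- the supercharacters are the same, up to explicit positive integer factors
    UnipOrth.supercharacters f θ =
      {χ | ∃ (D : Finset (Fin n × Fin n)) (φ : Fin n × Fin n → F),
        UnipOrth.IsBasic D ∧ (∀ p ∈ D, φ p ≠ 0) ∧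
        χ = ((Nat.card F : ℂ) ^ UnipOrth.normExponent D) • UnipOrth.anSupercharacter θ' D φ} ∧
    (Even n → UnipOrth.supercharacters f θ = UnipOrth.anSupercharacters n θ') := by
  open UnipOrth in
  have := Fintype.ofFinite (UT n F)
  have hcongr : ∀ (D : Finset (Fin n × Fin n)) (φ φ' : Fin n × Fin n → F),
      (∀ p ∈ D, φ p = φ' p) → anSupercharacter (n := n) θ' D φ = anSupercharacter θ' D φ' :=
    fun D φ φ' h => funext fun u => Finset.prod_congr rfl fun p hp => by rw [h p hp]
  have hX := supercharacters_eq_image hF f hθ hθ'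
  have hY : anSupercharacters n θ' = _ :=
    setOf_isBasic_eq_image (anSupercharacter (n := n) θ') hcongr
  have hX' := setOf_isBasic_eq_image
    (fun D φ => ((Nat.card F : ℂ) ^ normExponent D) • anSupercharacter (n := n) θ' D φ)
    fun D φ φ' h => by rw [hcongr D φ φ' h]
  have hclass := superclasses_eq_anSuperclasses hF f
  have hchar : ∀ e ∈ basics n F,
      IsCharacter (anSupercharacter (n := n) θ' (rootSet e) fun p => e p.1 p.2) := fun e he =>
    isCharacter_anSupercharacter θ' (isBasic_rootSet he) _
  have hq : (Nat.card F : ℂ) ≠ 0 := Nat.cast_ne_zero.mpr Nat.card_pos.ne'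
  refine ⟨?_, ?_, hclass, superclasses_eq_algSuperclasses hF f, hX.trans hX'.symm, fun hn => ?_⟩
  -- The χ_λ are characters because they are positive integer multiples of products of induced
  -- characters.
  · rw [hX]
    refine isSupercharacterTheory_of_orbitAvg hF f hθ' _
      (fun e => (Nat.card F : ℂ) ^ normExponent (rootSet e) *
        (Nat.card F : ℂ) ^ rootDegree (rootSet e)) (fun e he u => ?_) (fun e he => ?_)
      fun e _ => mul_ne_zero (pow_ne_zero _ hq) (pow_ne_zero _ hq)
    · rw [Pi.smul_apply, smul_eq_mul, anSupercharacter_eq_expect hF f hθ' he, mul_assoc]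
      rfl
    · have := (hchar e he).natCast_smul (pow_pos (Nat.card_pos (α := F)) (normExponent (rootSet e)))
      rwa [Nat.cast_pow] at this
  · rw [hY, ← hclass]
    exact isSupercharacterTheory_of_orbitAvg hF f hθ' _
      (fun e => (Nat.card F : ℂ) ^ rootDegree (rootSet e))
      (fun e he u => anSupercharacter_eq_expect hF f hθ' he u) hchar
      fun e _ => pow_ne_zero _ hq
  · rw [hX, hY]
    refine Set.image_congr fun e _ => ?_
    rw [normExponent, if_pos hn, pow_zero, one_smul]
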